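/- Let $1\le p\le m$ and $m+p\le n$ be integers and let $\sigma>0$. Let $\mathbf x:\mathbb R^p\to\mathbb C^n$ have partial derivatives $\mathbf g_j=\partial\mathbf x/\partial\theta_j$ at $\theta$, let $\mathbf G=[\mathbf g_1,\dots,\mathbf g_p]\in\mathbb C^{n\times p}$, and suppose that the Fisher information matrix before compression, $\mathbf J=\sigma^{-2}\mathbf G^H\mathbf G$, of the model $\mathcal{CN}(\mathbf x(\theta),\sigma^2\mathbf I)$ is invertible. Let $\mathbf\Phi$ be a random matrix in $\mathbb C^{m\times n}$ that satisfies one of the following: (a) its entries are i.i.d. $\mathcal{CN}(0,1)$; (b) it has a density of the form $g(\mathbf\Phi\mathbf\Phi^H)$ with respect to Lebesgue measure on $\mathbb C^{m\times n}$; (c) its distribution is right-unitarily invariant ($\mathbf\Phi\mathbf U$ has the same distribution as $\mathbf\Phi$ for every deterministic unitary $\mathbf U\in\mathbb C^{n\times n}$), and $\mathbf\Phi\mathbf\Phi^H$ is almost surely invertible. Let $\mathbf P=\mathbf\Phi^H(\mathbf\Phi\mathbf\Phi^H)^{-1}\mathbf\Phi$ and let $\hat{\mathbf J}=\sigma^{-2}(\mathbf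 P\mathbf G)^H(\mathbf P\mathbf G)$ be the Fisher information matrix after compression by $\mathbf\Phi$. Then $\mathbf\Phi\mathbf\Phi^H$ and $\hat{\mathbf J}$ are almost surely invertible, and for each $i\in\{1,\dots,p\}$ the ratio of the Cramér–Rao bound (CRB) for $\theta_i$ after compression to that before compression has the following properties. 1. For every square root $\mathbf J^{1/2}$ of $\mathbf J$ (a matrix with $\mathbf J^{1/2}\mathbf J^{H/2}=\mathbf J$, where $\mathbf J^{H/2}=(\mathbf J^{1/2})^H$), with $\mathbf W=\mathbf J^{-1/2}\hat{\mathbf J}\mathbf J^{-H/2}$ and $\mathbf z=\mathbf J^{-1/2}\mathbf e_i$ ($\mathbf e_i$ the $i$-th standard unit vector), almost surely $$\frac{(\hat{\mathbf J}^{-1})_{ii}}{(\mathbf J^{-1})_{ii}}=\frac{\mathbf z^H\mathbf W^{-1}\mathbf z}{\mathbf z^H\mathbf z}.$$ 2. This ratio is distributed as $1/b$, where $b$ is a univariate $\mathrm{Beta}(m-p+1,\,n-m)$ random variable, that is, $b$ has density $\frac{\Gamma(n-p+1)}{\Gamma(m-p+1)\Gamma(n-m)}\,b^{m-p}(1-b)^{n-m-1}$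 on $(0,1)$. In particular, the distribution does not depend on $\mathbf J$. -/

import Mathlib

open MeasureTheory ProbabilityTheory Matrix
open scoped ENNReal

noncomputable section

/-- The sensitivity matrix `G = [g₁, …, g_p]` of a mean vector `x : ℝ^p → ℂ^n` at `θ`: its
`j`-th column is the partial derivative `∂x/∂θ_j`. -/
def sensitivityMatrix {n p : ℕ} (x : (Fin p → ℝ) → (Fin n → ℂ)) (θ : Fin p → ℝ) :
    Matrix (Fin n) (Fin p) ℂ :=
  Matrix.of fun k j => deriv (fun t : ℝ => x (Function.update θ j t)) (θ j) k

/-- The Fisher information matrix `J = σ⁻² Gᴴ G` before compression, for measurements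
distributed as `CN(x(θ), σ² I)`. -/
def fisherInfo {n p : ℕ} (σ : ℝ) (x : (Fin p → ℝ) → (Fin n → ℂ)) (θ : Fin p → ℝ) :
    Matrix (Fin p) (Fin p) ℂ :=
  (((1 / σ ^ 2 : ℝ)) : ℂ) • ((sensitivityMatrix x θ)ᴴ * sensitivityMatrix x θ)

/-- `P = Φᴴ (Φ Φᴴ)⁻¹ Φ`, for `Φ` of full row rank the orthogonal projection onto the column space
of `Φᴴ`. -/
def rowProj {m n : ℕ} (Φ : Matrix (Fin m) (Fin n) ℂ) : Matrix (Fin n) (Fin n) ℂ :=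
  Φᴴ * (Φ * Φᴴ)⁻¹ * Φ

/-- The Fisher information matrix after compression by `Φ`: `Ĵ = σ⁻² Ĝᴴ Ĝ` with `Ĝ = P G`. -/
def compressedFisherInfo {m n p : ℕ} (σ : ℝ) (x : (Fin p → ℝ) → (Fin n → ℂ)) (θ : Fin p → ℝ)
    (Φ : Matrix (Fin m) (Fin n) ℂ) : Matrix (Fin p) (Fin p) ℂ :=
  (((1 / σ ^ 2 : ℝ)) : ℂ) •
    ((rowProj Φ * sensitivityMatrix x θ)ᴴ * (rowProj Φ * sensitivityMatrix x θ))

/-- The normalized Fisher information `W = J^{-1/2} Ĵ J^{-H/2}`, where `L` is the chosen square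
root `J^{1/2}` (a matrix with `L Lᴴ = J`). -/
def normalizedFisherInfo {p : ℕ} (L Jhat : Matrix (Fin p) (Fin p) ℂ) :
    Matrix (Fin p) (Fin p) ℂ :=
  L⁻¹ * Jhat * (Lᴴ)⁻¹

/-- The standard proper complex normal distribution `CN(0,1)`, with density `π⁻¹ exp(-|z|²)`
with respect to Lebesgue measure on `ℂ`. -/
def stdComplexNormal : Measure ℂ :=
  volume.withDensity fun z => ENNReal.ofReal (Real.exp (-‖z‖ ^ 2) / Real.pi)

/-- The entries of the random matrix `Φ` are i.i.d. with distribution `CN(0,1)`. -/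
def IsIIDComplexNormal {Ω : Type*} [MeasurableSpace Ω] (μ : Measure Ω) {m n : ℕ}
    (Φ : Ω → Matrix (Fin m) (Fin n) ℂ) : Prop :=
  iIndepFun (fun (ij : Fin m × Fin n) ω => Φ ω ij.1 ij.2) μ ∧
    ∀ i j, HasLaw (fun ω => Φ ω i j) stdComplexNormal μ

/-- The random matrix `Φ` has a density of the form `A ↦ g (A Aᴴ)` with respect to Lebesgue
measure on `ℂ^{m × n}`. -/
def HasGramDensity {Ω : Type*} [MeasurableSpace Ω] (μ : Measure Ω) {m n : ℕ}
    (Φ : Ω → Matrix (Fin m) (Fin n) ℂ) : Prop :=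
  ∃ g : Matrix (Fin m) (Fin m) ℂ → ℝ≥0∞,
    Measurable (fun A : Fin m → Fin n → ℂ => g (Matrix.of A * (Matrix.of A)ᴴ)) ∧
    HasLaw (fun ω k l => Φ ω k l)
      ((volume : Measure (Fin m → Fin n → ℂ)).withDensity
        fun A => g (Matrix.of A * (Matrix.of A)ᴴ)) μ

/-- The distribution of the random matrix `Φ` is invariant under right multiplication by every
(deterministic) unitary matrix, and `Φ` almost surely has full row rank, so that `(Φ Φᴴ)⁻¹`
exists. -/
def IsRightUnitarilyInvariant {Ω : Type*} [MeasurableSpace Ω] (μ : Measure Ω) {m n : ℕ}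
    (Φ : Ω → Matrix (Fin m) (Fin n) ℂ) : Prop :=
  AEMeasurable (fun ω k l => Φ ω k l : Ω → Fin m → Fin n → ℂ) μ ∧
  (∀ U ∈ Matrix.unitaryGroup (Fin n) ℂ,
    μ.map (fun ω k l => (Φ ω * U) k l : Ω → Fin m → Fin n → ℂ) =
      μ.map (fun ω k l => Φ ω k l : Ω → Fin m → Fin n → ℂ)) ∧
  ∀ᵐ ω ∂μ, IsUnit (Φ ω * (Φ ω)ᴴ)

end

/-! The factor σ⁻² cancels, and the ratio becomes pure geometry. Let `S` be the span of the columns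
of `G` other than the `i`-th and `N` the null space of `Φ`. A diagonal entry of an inverse Gram
matrix is the inverse squared norm of a residual: the entry before compression is 1/‖q‖², with q the
component of the `i`-th column orthogonal to `S`, and the entry after compression uses the component
orthogonal to `N ⊔ S` (`compressed_gram_inv_apply_self`, `gram_inv_apply_self`). Since `(N ⊔ S)ᗮ ≤
Sᗮ`, the reciprocal of the ratio is the squared cosine of the angle between q and `(N ⊔ S)ᗮ`. When
`ΦG` is injective, this subspace has dimension m - p + 1 inside `Sᗮ`, which has dimension n - p + 1;
its complement there has dimension n - m.

The randomness is moved from the subspace to the vector. For nonzero v in `Sᗮ`, some unitary fixes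
`S` and sends q to a nonzero multiple of v, and invertible column operations confined to column `i`
do not change the ratio (`exists_unitary_mul_eq_updateCol_mul`, `crbRatio_mul_right`). By
right-unitary invariance the law is unchanged when q is replaced by v, so it may be averaged over v
in the unit ball of `Sᗮ` (`RightUnitarilyInvariant.lintegral_mul_measure_univ`). With `Φ` fixed and
v uniform, polar coordinates in a subspace and in its complement give the Beta law
(`setLIntegral_ball_starProjection_beta`).

The same averaging, by induction on the number of columns, shows that `ΦG` is almost surely
injective. Hypothesis (a) is a case of (b), and (b) implies (c) because Lebesgue measure and the
Gram matrix are invariant and matrices of deficient row rank form a null set. -/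

/-! ### Radial integration and the Beta distribution -/

/-- Polar coordinates for the Lebesgue integral of a radial function. -/
theorem lintegral_fun_norm_addHaar {E : Type*} [NormedAddCommGroup E] [NormedSpace ℝ E]
    [FiniteDimensional ℝ E] [Nontrivial E] [MeasurableSpace E] [BorelSpace E]
    (μ : Measure E) [μ.IsAddHaarMeasure] (f : ℝ → ℝ≥0∞) (hf : Measurable f) :
    ∫⁻ x, f ‖x‖ ∂μ = μ.toSphere Set.univ *
      ∫⁻ r in Set.Ioi (0 : ℝ), ENNReal.ofReal (r ^ (Module.finrank ℝ E - 1)) * f r := by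
  calc
    ∫⁻ x, f ‖x‖ ∂μ = ∫⁻ x : ({(0)}ᶜ : Set E), f ‖x.1‖ ∂(μ.comap (↑)) := by
      rw [lintegral_subtype_comap (measurableSet_singleton _).compl fun x ↦ f ‖x‖,
        MeasureTheory.restrict_compl_singleton]
    _ = ∫⁻ x, f x.2 ∂μ.toSphere.prod (.volumeIoiPow (Module.finrank ℝ E - 1)) := by
      simpa using μ.measurePreserving_homeomorphUnitSphereProd.lintegral_comp_emb
        (Homeomorph.measurableEmbedding _) (f ∘ Subtype.val ∘ Prod.snd)
    _ = μ.toSphere Set.univ *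
          ∫⁻ x : Set.Ioi (0 : ℝ), f x ∂.volumeIoiPow (Module.finrank ℝ E - 1) := by
      have := lintegral_prod_mul (μ := μ.toSphere)
        (ν := Measure.volumeIoiPow (Module.finrank ℝ E - 1)) (f := fun _ => 1)
        (g := fun x => f x) aemeasurable_const (hf.comp measurable_subtype_coe).aemeasurable
      simpa using this
    _ = _ := by
      rw [Measure.volumeIoiPow, lintegral_withDensity_eq_lintegral_mul _ (by fun_prop)
        (by fun_prop)]
      congr 1
      exact lintegral_subtype_comap measurableSet_Ioi
        (fun r : ℝ => ENNReal.ofReal (r ^ (Module.finrank ℝ E - 1)) * f r)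

theorem setLIntegral_Ioi_comp_mul_left {a : ℝ} (ha : 0 < a) (f : ℝ → ℝ≥0∞) :
    ∫⁻ r in Set.Ioi (0 : ℝ), f r = ∫⁻ w in Set.Ioi (0 : ℝ), ENNReal.ofReal a * f (a * w) := by
  have h := lintegral_image_eq_lintegral_abs_deriv_mul (s := Set.Ioi (0 : ℝ))
    (f := fun w => a * w) (f' := fun _ => a) measurableSet_Ioi
    (fun x _ => by simpa using ((hasDerivAt_id x).const_mul a).hasDerivWithinAt)
    (fun x _ y _ h => mul_left_cancel₀ ha.ne' h) f
  have h2 : (fun w => a * w) '' Set.Ioi (0 : ℝ) = Set.Ioi 0 := by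
    rw [Set.image_mul_left_Ioi ha]; simp
  rw [h2] at h
  simpa [abs_of_pos ha] using h

/-- Substitution u = w²/(1+w²). Here w plays the role of the quotient r/s of two radii, so that u =
r²/(r²+s²). -/
theorem lintegral_betaMeasure {k l : ℕ} (hk : 0 < k) (hl : 0 < l) (h : ℝ → ℝ≥0∞)
    (hh : Measurable h) :
    ∫⁻ u, h u ∂betaMeasure k l = ENNReal.ofReal (2 / beta k l) *
      ∫⁻ w in Set.Ioi (0 : ℝ), ENNReal.ofReal (w ^ (2 * k - 1) * ((1 + w ^ 2) ^ (k + l))⁻¹) *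
        h (w ^ 2 / (1 + w ^ 2)) := by
  have hb : 0 < beta (k : ℝ) l := beta_pos (by positivity) (by positivity)
  have himg : (fun w : ℝ => w ^ 2 / (1 + w ^ 2)) '' Set.Ioi 0 = Set.Ioo 0 1 := by
    ext u
    constructor
    · rintro ⟨w, hw, rfl⟩
      have hw : 0 < w := hw
      exact ⟨by positivity, by rw [div_lt_one (by positivity)]; linarith⟩
    · rintro ⟨h0, h1⟩
      have h2 : 0 < u / (1 - u) := div_pos h0 (by linarith)
      refine ⟨√(u / (1 - u)), Real.sqrt_pos.2 h2, ?_⟩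
      have : 1 - u ≠ 0 := by linarith
      simp only [Real.sq_sqrt h2.le]
      field_simp
      ring
  have hinj : Set.InjOn (fun w : ℝ => w ^ 2 / (1 + w ^ 2)) (Set.Ioi 0) := by
    intro x hx y hy hxy
    have hx : 0 < x := hx
    have hy : 0 < y := hy
    have h1 : (1 + x ^ 2) ≠ 0 := by positivity
    have h2 : (1 + y ^ 2) ≠ 0 := by positivity
    simp only [div_eq_div_iff h1 h2] at hxy
    have : x ^ 2 = y ^ 2 := by linarith
    exact (pow_left_inj₀ hx.le hy.le two_ne_zero).1 this
  have hder : ∀ x ∈ Set.Ioi (0 : ℝ), HasDerivWithinAt (fun w : ℝ => w ^ 2 / (1 + w ^ 2))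
      (2 * x / (1 + x ^ 2) ^ 2) (Set.Ioi 0) x := by
    intro x hx
    have h1 : (1 + x ^ 2) ≠ 0 := by positivity
    have hd := ((hasDerivAt_pow 2 x).fun_div ((hasDerivAt_pow 2 x).const_add 1) h1).hasDerivWithinAt
      (s := Set.Ioi 0)
    have e : 2 * x / (1 + x ^ 2) ^ 2 = (((2 : ℕ) : ℝ) * x ^ (2 - 1) * (1 + x ^ 2) -
        x ^ 2 * (((2 : ℕ) : ℝ) * x ^ (2 - 1))) / (1 + x ^ 2) ^ 2 := by
      push_cast; congr 1; ring
    rw [e]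
    exact hd
  have hset : ∫⁻ u, h u ∂betaMeasure k l = ∫⁻ u in Set.Ioo (0 : ℝ) 1, betaPDF k l u * h u := by
    have hm : Measurable (betaPDF (k : ℝ) l) := (measurable_betaPDFReal _ _).ennreal_ofReal
    rw [betaMeasure, lintegral_withDensity_eq_lintegral_mul _ hm hh,
      ← lintegral_indicator measurableSet_Ioo]
    refine lintegral_congr fun u => ?_
    by_cases hu : u ∈ Set.Ioo (0 : ℝ) 1
    · simp [hu]
    · rw [Set.indicator_of_notMem hu, Pi.mul_apply]
      rcases not_and_or.1 hu with h' | h'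
      · rw [betaPDF_eq_zero_of_nonpos (not_lt.1 h'), zero_mul]
      · rw [betaPDF_eq_zero_of_one_le (not_lt.1 h'), zero_mul]
  rw [hset, ← himg, lintegral_image_eq_lintegral_abs_deriv_mul measurableSet_Ioi hder hinj,
    ← lintegral_const_mul _ (by fun_prop)]
  refine setLIntegral_congr_fun measurableSet_Ioi fun w hw => ?_
  have hw : 0 < w := hw
  have hmem : w ^ 2 / (1 + w ^ 2) ∈ Set.Ioo (0 : ℝ) 1 :=
    ⟨by positivity, by rw [div_lt_one (by positivity)]; linarith⟩
  have hone : 1 - w ^ 2 / (1 + w ^ 2) = (1 + w ^ 2)⁻¹ := by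
    have : (1 + w ^ 2) ≠ 0 := by positivity
    field_simp; ring
  rw [betaPDF_of_pos_lt_one hmem.1 hmem.2, hone, ← mul_assoc, ← mul_assoc,
    ← ENNReal.ofReal_mul (by positivity), ← ENNReal.ofReal_mul (by positivity)]
  congr 2
  obtain ⟨k, rfl⟩ : ∃ k', k = k' + 1 := ⟨k - 1, by omega⟩
  obtain ⟨l, rfl⟩ : ∃ l', l = l' + 1 := ⟨l - 1, by omega⟩
  rw [abs_of_pos (by positivity)]
  have e1 : ((k + 1 : ℕ) : ℝ) - 1 = k := by push_cast; ring
  have e2 : ((l + 1 : ℕ) : ℝ) - 1 = l := by push_cast; ring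
  have e3 : 2 * (k + 1) - 1 = 2 * k + 1 := by omega
  rw [e1, e2, e3, Real.rpow_natCast, Real.rpow_natCast, div_pow, inv_pow]
  field_simp
  ring

/-- If `r` and `s` have a joint density proportional to `r ^ (2k-1) * s ^ (2l-1) * φ (r² + s²)`,
then `r² / (r² + s²)` has a `Beta(k, l)` distribution. -/
theorem exists_lintegral_radial_beta {k l : ℕ} (hk : 0 < k) (hl : 0 < l) (φ : ℝ → ℝ≥0∞)
    (hφ : Measurable φ) : ∃ C : ℝ≥0∞, ∀ h : ℝ → ℝ≥0∞, Measurable h →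
      ∫⁻ s in Set.Ioi (0 : ℝ), ENNReal.ofReal (s ^ (2 * l - 1)) *
        ∫⁻ r in Set.Ioi (0 : ℝ), ENNReal.ofReal (r ^ (2 * k - 1)) *
          (φ (r ^ 2 + s ^ 2) * h (r ^ 2 / (r ^ 2 + s ^ 2))) =
      C * ∫⁻ u, h u ∂betaMeasure k l := by
  have hb : 0 < beta (k : ℝ) l := beta_pos (by positivity) (by positivity)
  set C₀ : ℝ≥0∞ := ∫⁻ t in Set.Ioi (0 : ℝ), ENNReal.ofReal (t ^ (2 * (k + l) - 1)) * φ (t ^ 2)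
  -- The substitution t = s√(1+w²) separates the variables; the power of 1+w² it leaves is the one
  -- in the Beta integrand.
  have key : ∀ w : ℝ, 0 < w → ∫⁻ s in Set.Ioi (0 : ℝ), ENNReal.ofReal (s ^ (2 * (k + l) - 1)) *
      φ (s ^ 2 * (1 + w ^ 2)) = ENNReal.ofReal (((1 + w ^ 2) ^ (k + l))⁻¹) * C₀ := by
    intro w hw
    obtain ⟨a, ha, hsq⟩ : ∃ a : ℝ, 0 < a ∧ a ^ 2 = 1 + w ^ 2 :=
      ⟨√(1 + w ^ 2), Real.sqrt_pos.2 (by positivity), Real.sq_sqrt (by positivity)⟩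
    rw [show C₀ = _ from setLIntegral_Ioi_comp_mul_left ha _,
      ← lintegral_const_mul _ (by fun_prop)]
    refine setLIntegral_congr_fun measurableSet_Ioi fun s hs => ?_
    have hs : 0 < s := hs
    rw [← mul_assoc, ← mul_assoc, ← ENNReal.ofReal_mul (by positivity),
      ← ENNReal.ofReal_mul (by positivity), mul_pow _ _ 2, hsq, mul_comm (1 + w ^ 2) (s ^ 2)]
    congr 2
    rw [← hsq, ← pow_mul, mul_pow]
    have : 2 * (k + l) = (2 * (k + l) - 1) + 1 := by omega
    rw [mul_assoc, ← mul_assoc a, ← pow_succ', ← this, ← mul_assoc,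
      inv_mul_cancel₀ (by positivity), one_mul]
  -- The second factor cancels the normalizing constant of `lintegral_betaMeasure`. `C₀` may be
  -- infinite.
  refine ⟨C₀ * (ENNReal.ofReal (2 / beta k l))⁻¹, fun h hh => ?_⟩
  rw [lintegral_betaMeasure hk hl h hh, ← mul_assoc, mul_assoc C₀, ENNReal.inv_mul_cancel
    (by rw [ne_eq, ENNReal.ofReal_eq_zero, not_le]; positivity) ENNReal.ofReal_ne_top, mul_one,
    ← lintegral_const_mul _ (by fun_prop)]
  -- Substitute r = s·w in the inner integral, then integrate over s first.
  have step : ∀ s ∈ Set.Ioi (0 : ℝ), ENNReal.ofReal (s ^ (2 * l - 1)) *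
        ∫⁻ r in Set.Ioi (0 : ℝ), ENNReal.ofReal (r ^ (2 * k - 1)) *
          (φ (r ^ 2 + s ^ 2) * h (r ^ 2 / (r ^ 2 + s ^ 2))) =
      ∫⁻ w in Set.Ioi (0 : ℝ), ENNReal.ofReal (w ^ (2 * k - 1)) * h (w ^ 2 / (1 + w ^ 2)) *
        (ENNReal.ofReal (s ^ (2 * (k + l) - 1)) * φ (s ^ 2 * (1 + w ^ 2))) := by
    intro s hs
    have hs : 0 < s := hs
    rw [setLIntegral_Ioi_comp_mul_left hs, ← lintegral_const_mul _ (by fun_prop)]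
    refine setLIntegral_congr_fun measurableSet_Ioi fun w hw => ?_
    have hw : 0 < w := hw
    have e1 : (s * w) ^ 2 + s ^ 2 = s ^ 2 * (1 + w ^ 2) := by ring
    have e2 : (s * w) ^ 2 / (s ^ 2 * (1 + w ^ 2)) = w ^ 2 / (1 + w ^ 2) := by
      field_simp
    have e3 : ENNReal.ofReal (s ^ (2 * (k + l) - 1)) = ENNReal.ofReal (s ^ (2 * l - 1)) *
        ENNReal.ofReal s * ENNReal.ofReal (s ^ (2 * k - 1)) := by
      rw [← ENNReal.ofReal_mul (by positivity), ← ENNReal.ofReal_mul (by positivity),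
        ← pow_succ, ← pow_add]
      congr 2; omega
    simp only [e1, e2]
    rw [e3, mul_pow, ENNReal.ofReal_mul (by positivity)]
    ring
  rw [setLIntegral_congr_fun measurableSet_Ioi step, lintegral_lintegral_swap]
  · refine setLIntegral_congr_fun measurableSet_Ioi fun w hw => ?_
    have hw : 0 < w := hw
    rw [lintegral_const_mul _ (by fun_prop), key w hw, ENNReal.ofReal_mul (by positivity)]
    ring
  · apply Measurable.aemeasurable
    simp only [Function.uncurry_def]
    fun_prop

/-- Up to a constant, Haar measure is the product of Haar measures on `K` and `Kᗮ`, and ‖v‖² splits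
by Pythagoras. Polar coordinates in each factor, whose real dimensions are twice the complex ones,
reduce the integral to `exists_lintegral_radial_beta`. The constant need not be known: it is the
same for every `h`. -/
theorem exists_lintegral_starProjection_beta {V : Type*} [NormedAddCommGroup V]
    [InnerProductSpace ℂ V] [FiniteDimensional ℂ V] [MeasurableSpace V] [BorelSpace V]
    (μ : Measure V) [μ.IsAddHaarMeasure] (K : Submodule ℂ V)
    (hk : 0 < Module.finrank ℂ K) (hl : 0 < Module.finrank ℂ Kᗮ)
    (φ : ℝ → ℝ≥0∞) (hφ : Measurable φ) : ∃ C : ℝ≥0∞, ∀ h : ℝ → ℝ≥0∞, Measurable h →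
      ∫⁻ v, φ (‖v‖ ^ 2) * h (‖K.starProjection v‖ ^ 2 / ‖v‖ ^ 2) ∂μ =
        C * ∫⁻ u, h u ∂betaMeasure (Module.finrank ℂ K) (Module.finrank ℂ Kᗮ) := by
  obtain ⟨C, hC⟩ := exists_lintegral_radial_beta hk hl φ hφ
  have : Nontrivial K := Module.nontrivial_of_finrank_pos hk
  have : Nontrivial Kᗮ := Module.nontrivial_of_finrank_pos hl
  let e : (K × Kᗮ) ≃L[ℂ] V := (Submodule.prodEquivOfIsCompl K Kᗮ
    K.isCompl_orthogonal).toContinuousLinearEquiv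
  have he : ∀ z : K × Kᗮ, e z = z.1 + z.2 := fun z => by simp [e]
  let νK : Measure K := Measure.addHaar
  let νL : Measure Kᗮ := Measure.addHaar
  have hmap : ((νK.prod νL).map e).IsAddHaarMeasure := e.isAddHaarMeasure_map _
  have hsmul := Measure.isAddLeftInvariant_eq_smul μ ((νK.prod νL).map e)
  set c := μ.addHaarScalarFactor ((νK.prod νL).map e)
  have hnorm : ∀ z : K × Kᗮ, ‖e z‖ ^ 2 = ‖z.1‖ ^ 2 + ‖z.2‖ ^ 2 := fun z => by
    rw [he, sq, sq, sq, norm_add_sq_eq_norm_sq_add_norm_sq_of_inner_eq_zero (𝕜 := ℂ)]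
    · simp
    · exact K.inner_right_of_mem_orthogonal z.1.2 z.2.2
  have hproj : ∀ z : K × Kᗮ, K.starProjection (e z) = z.1 := fun z => by
    rw [he, map_add, Submodule.starProjection_eq_self_iff.2 z.1.2,
      (Submodule.starProjection_apply_eq_zero_iff _).2 z.2.2, add_zero]
  refine ⟨c * (νL.toSphere Set.univ * (νK.toSphere Set.univ * C)), fun h hh => ?_⟩
  have hrk : ∀ W : Submodule ℂ V, Module.finrank ℝ W = 2 * Module.finrank ℂ W := fun W =>
    finrank_real_of_complex W
  rw [hsmul, lintegral_smul_measure, ENNReal.smul_def, smul_eq_mul, mul_assoc,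
    lintegral_map (by fun_prop) e.continuous.measurable]
  congr 1
  simp only [hnorm, hproj, Submodule.norm_coe]
  rw [lintegral_prod_symm' _ (by fun_prop), mul_assoc, mul_assoc, ← hC h hh, ← hrk, ← hrk]
  have h1 : ∀ y : Kᗮ, ∫⁻ x : K, φ (‖x‖ ^ 2 + ‖y‖ ^ 2) * h (‖x‖ ^ 2 / (‖x‖ ^ 2 + ‖y‖ ^ 2)) ∂νK =
      νK.toSphere Set.univ * ∫⁻ r in Set.Ioi (0 : ℝ),
        ENNReal.ofReal (r ^ (Module.finrank ℝ K - 1)) *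
          (φ (r ^ 2 + ‖y‖ ^ 2) * h (r ^ 2 / (r ^ 2 + ‖y‖ ^ 2))) := fun y =>
    lintegral_fun_norm_addHaar νK
      (fun r => φ (r ^ 2 + ‖y‖ ^ 2) * h (r ^ 2 / (r ^ 2 + ‖y‖ ^ 2))) (by fun_prop)
  simp only [h1]
  rw [lintegral_const_mul _ (by fun_prop), mul_left_comm]
  congr 1
  exact lintegral_fun_norm_addHaar νL (fun s => ∫⁻ r in Set.Ioi (0 : ℝ),
        ENNReal.ofReal (r ^ (Module.finrank ℝ K - 1)) *
          (φ (r ^ 2 + s ^ 2) * h (r ^ 2 / (r ^ 2 + s ^ 2)))) (by fun_prop)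

/-- For a uniform point of the unit ball of a complex inner product space, the squared cosine of
the angle to a subspace `K` has a `Beta(dim K, dim Kᗮ)` distribution. -/
theorem setLIntegral_ball_starProjection_beta {V : Type*} [NormedAddCommGroup V]
    [InnerProductSpace ℂ V] [FiniteDimensional ℂ V] [MeasurableSpace V] [BorelSpace V]
    (μ : Measure V) [μ.IsAddHaarMeasure] (K : Submodule ℂ V)
    (hk : 0 < Module.finrank ℂ K) (hl : 0 < Module.finrank ℂ Kᗮ)
    (h : ℝ → ℝ≥0∞) (hh : Measurable h) :
    ∫⁻ v in Metric.ball 0 1, h (‖K.starProjection v‖ ^ 2 / ‖v‖ ^ 2) ∂μ =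
      μ (Metric.ball 0 1) *
        ∫⁻ u, h u ∂betaMeasure (Module.finrank ℂ K) (Module.finrank ℂ Kᗮ) := by
  obtain ⟨C, hC⟩ := exists_lintegral_starProjection_beta μ K hk hl
    ((Set.Iio 1).indicator 1) (measurable_one.indicator measurableSet_Iio)
  have key : ∀ h : ℝ → ℝ≥0∞, Measurable h →
      ∫⁻ v in Metric.ball 0 1, h (‖K.starProjection v‖ ^ 2 / ‖v‖ ^ 2) ∂μ =
        C * ∫⁻ u, h u ∂betaMeasure (Module.finrank ℂ K) (Module.finrank ℂ Kᗮ) := fun h hh => by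
    rw [← hC h hh, ← lintegral_indicator Metric.isOpen_ball.measurableSet]
    refine lintegral_congr fun v => ?_
    by_cases hv : ‖v‖ < 1
    · have : ‖v‖ ^ 2 < 1 := by
        rw [sq_lt_one_iff_abs_lt_one, abs_norm]; exact hv
      simp [hv, this]
    · have : ¬ ‖v‖ ^ 2 < 1 := by
        rw [sq_lt_one_iff_abs_lt_one, abs_norm]; exact hv
      simp [hv, this]
  have := isProbabilityMeasureBeta (α := Module.finrank ℂ K) (β := Module.finrank ℂ Kᗮ)
    (by exact_mod_cast hk) (by exact_mod_cast hl)
  -- Testing with `h = 1` identifies the constant as the volume of the ball.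
  have h1 := key 1 measurable_one
  simp only [Pi.one_apply, lintegral_one, measure_univ, mul_one, Measure.restrict_apply,
    MeasurableSet.univ, Set.univ_inter] at h1
  rw [key h hh, h1]

/-! ### Unitary maps that fix a subspace -/

section Householder

variable {E : Type*} [NormedAddCommGroup E] [InnerProductSpace ℂ E]

theorem Complex.exists_norm_eq_one_star_mul_eq_norm (z : ℂ) :
    ∃ u : ℂ, ‖u‖ = 1 ∧ star u * z = ‖z‖ := by
  refine ⟨Complex.exp (z.arg * Complex.I), Complex.norm_exp_ofReal_mul_I _, ?_⟩
  have h : star (Complex.exp (z.arg * Complex.I)) * Complex.exp (z.arg * Complex.I) = 1 := by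
    rw [← starRingEnd_apply, Complex.conj_mul', Complex.norm_exp_ofReal_mul_I]
    simp
  nth_rewrite 2 [← Complex.norm_mul_exp_arg_mul_I z]
  rw [mul_left_comm, h, mul_one]

/-- A complex Householder reflection swapping two vectors of equal norm with real inner product. -/
theorem Submodule.reflection_sub_of_inner_comm {v w : E} (h : ‖v‖ = ‖w‖)
    (hi : inner ℂ v w = inner ℂ w v) : (ℂ ∙ (v - w))ᗮ.reflection v = w := by
  have h1 : (ℂ ∙ (v - w))ᗮ.reflection (v + w) = v + w := by
    refine Submodule.reflection_mem_subspace_eq_self ?_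
    rw [Submodule.mem_orthogonal_singleton_iff_inner_right, inner_sub_left, inner_add_right,
      inner_add_right, hi, inner_self_eq_norm_sq_to_K, inner_self_eq_norm_sq_to_K, h]
    ring
  have h2 := Submodule.reflection_orthogonalComplement_singleton_eq_neg (𝕜 := ℂ) (v - w)
  have h3 : v = (2⁻¹ : ℂ) • ((v + w) + (v - w)) := by
    module
  calc (ℂ ∙ (v - w))ᗮ.reflection v
      = (2⁻¹ : ℂ) • ((ℂ ∙ (v - w))ᗮ.reflection (v + w) + (ℂ ∙ (v - w))ᗮ.reflection (v - w)) := by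
        rw [← map_add, ← map_smul, ← h3]
    _ = w := by
        rw [h1, h2]
        module

/-- Reflect the components q' and v' orthogonal to `S` onto one another, after scaling v'. The
reflecting hyperplane is orthogonal to a vector of `Sᗮ`, so it contains `S` and the reflection fixes
`S` pointwise. -/
theorem Submodule.exists_isometry_fixing_map_sub_smul_mem [FiniteDimensional ℂ E]
    (S : Submodule ℂ E) {q v : E} (hq : q ∉ S) (hv : v ∉ S) :
    ∃ U : E ≃ₗᵢ[ℂ] E, (∀ s ∈ S, U s = s) ∧ ∃ c : ℂ, c ≠ 0 ∧ U q - c • v ∈ S := by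
  have hne : ∀ x : E, x ∉ S → Sᗮ.starProjection x ≠ 0 := fun x hx h0 => hx (by
    rw [Submodule.starProjection_apply_eq_zero_iff, Submodule.orthogonal_orthogonal] at h0
    exact h0)
  have hsub : ∀ x : E, x - Sᗮ.starProjection x ∈ S := fun x => by
    have := Sᗮ.sub_starProjection_mem_orthogonal x
    rwa [Submodule.orthogonal_orthogonal] at this
  have hmem : ∀ x : E, Sᗮ.starProjection x ∈ Sᗮ := fun x => by simp
  have hq' := hne q hq
  have hv' := hne v hv
  have hqs := hsub q
  have hvs := hsub v
  have hqm := hmem q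
  have hvm := hmem v
  set q' := Sᗮ.starProjection q
  set v' := Sᗮ.starProjection v
  obtain ⟨u, hu, huz⟩ := Complex.exists_norm_eq_one_star_mul_eq_norm (inner ℂ v' q')
  -- The modulus of `c` equalizes the norms; its phase makes the inner product real, as a complex
  -- Householder reflection requires.
  set c : ℂ := (‖q'‖ / ‖v'‖ : ℝ) * u with hc
  have hc0 : c ≠ 0 := by
    refine mul_ne_zero ?_ (norm_ne_zero_iff.1 (by rw [hu]; exact one_ne_zero))
    exact_mod_cast div_ne_zero (norm_ne_zero_iff.2 hq') (norm_ne_zero_iff.2 hv')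
  have hnorm : ‖q'‖ = ‖c • v'‖ := by
    rw [norm_smul, hc, norm_mul, hu, mul_one, Complex.norm_real, Real.norm_of_nonneg (by positivity),
      div_mul_cancel₀ _ (norm_ne_zero_iff.2 hv')]
  have hinner : inner ℂ (c • v') q' = ((‖q'‖ / ‖v'‖ * ‖inner ℂ v' q'‖ : ℝ) : ℂ) := by
    rw [inner_smul_left, hc, map_mul, Complex.conj_ofReal, mul_assoc, starRingEnd_apply, huz]
    push_cast
    ring
  have hreal : inner ℂ q' (c • v') = inner ℂ (c • v') q' := by
    rw [← inner_conj_symm, hinner, Complex.conj_ofReal]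
  have hfix : ∀ s ∈ S, (ℂ ∙ (q' - c • v'))ᗮ.reflection s = s := fun s hs => by
    refine Submodule.reflection_mem_subspace_eq_self ?_
    rw [Submodule.mem_orthogonal_singleton_iff_inner_left]
    exact S.inner_right_of_mem_orthogonal hs (Sᗮ.sub_mem hqm (Sᗮ.smul_mem c hvm))
  refine ⟨(ℂ ∙ (q' - c • v'))ᗮ.reflection, hfix, c, hc0, ?_⟩
  have hqe : (ℂ ∙ (q' - c • v'))ᗮ.reflection q = (q - q') + c • v' := by
    conv_lhs => rw [← sub_add_cancel q q']
    rw [map_add, hfix _ hqs, Submodule.reflection_sub_of_inner_comm hnorm hreal]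
  rw [hqe]
  have : q - q' + c • v' - c • v = (q - q') - c • (v - v') := by module
  rw [this]
  exact S.sub_mem hqs (S.smul_mem c hvs)

end Householder

/-- The isometries of `EuclideanSpace ℂ (Fin n)` act by unitary matrices. -/
theorem LinearIsometryEquiv.exists_mem_unitaryGroup_mulVec {n : ℕ}
    (U : EuclideanSpace ℂ (Fin n) ≃ₗᵢ[ℂ] EuclideanSpace ℂ (Fin n)) :
    ∃ M ∈ Matrix.unitaryGroup (Fin n) ℂ, ∀ x, WithLp.toLp 2 (M *ᵥ x) = U (WithLp.toLp 2 x) := by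
  set M : Matrix (Fin n) (Fin n) ℂ := Matrix.toEuclideanLin.symm U.toLinearEquiv.toLinearMap with hM
  have hx : ∀ x, WithLp.toLp 2 (M *ᵥ x) = U (WithLp.toLp 2 x) := fun x => by
    have h := Matrix.toLpLin_toLp 2 2 M x
    rw [Matrix.toLin'_apply] at h
    rw [← h, hM, LinearEquiv.apply_symm_apply]
    rfl
  refine ⟨M, ?_, hx⟩
  rw [Matrix.mem_unitaryGroup_iff', star_eq_conjTranspose]
  ext k l
  have h1 := U.inner_map_map (WithLp.toLp 2 (Pi.single k 1)) (WithLp.toLp 2 (Pi.single l 1))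
  rw [← hx, ← hx, EuclideanSpace.inner_toLp_toLp, EuclideanSpace.inner_toLp_toLp] at h1
  simp only [mulVec_single_one] at h1
  rw [mul_apply, one_apply]
  simp only [dotProduct, Matrix.col_apply, Pi.star_apply] at h1
  simp only [conjTranspose_apply]
  rw [Finset.sum_congr rfl fun _ _ => mul_comm _ _, h1]
  simp [Pi.single_apply, eq_comm]

/-! ### The ratio of the bounds as a squared cosine -/

/-- The ratio of the `i`-th Cramér–Rao bounds after and before compression by `A`, in terms of the
sensitivity matrix `G`. -/
noncomputable def crbRatio {m n p : ℕ} (A : Matrix (Fin m) (Fin n) ℂ) (G : Matrix (Fin n) (Fin p) ℂ)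
    (i : Fin p) : ℂ :=
  ((rowProj A * G)ᴴ * (rowProj A * G))⁻¹ i i / (Gᴴ * G)⁻¹ i i

/-- The span of the columns of `G` other than the `i`-th. -/
def otherCols {n p : ℕ} (G : Matrix (Fin n) (Fin p) ℂ) (i : Fin p) :
    Submodule ℂ (EuclideanSpace ℂ (Fin n)) :=
  (LinearMap.ker (LinearMap.proj i : (Fin p → ℂ) →ₗ[ℂ] ℂ)).map
    ((WithLp.linearEquiv 2 ℂ (Fin n → ℂ)).symm.toLinearMap ∘ₗ G.mulVecLin)

/-- The null space of `A`, as a subspace of Euclidean space. -/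
def nullSpace {m n : ℕ} (A : Matrix (Fin m) (Fin n) ℂ) :
    Submodule ℂ (EuclideanSpace ℂ (Fin n)) :=
  LinearMap.ker (A.mulVecLin ∘ₗ (WithLp.linearEquiv 2 ℂ (Fin n → ℂ)).toLinearMap)

section Algebra

variable {m n p : ℕ}

theorem mem_otherCols {G : Matrix (Fin n) (Fin p) ℂ} {i : Fin p}
    {x : EuclideanSpace ℂ (Fin n)} :
    x ∈ otherCols G i ↔ ∃ a : Fin p → ℂ, a i = 0 ∧ WithLp.toLp 2 (G *ᵥ a) = x := by
  simp [otherCols]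

theorem mem_nullSpace {A : Matrix (Fin m) (Fin n) ℂ} {x : EuclideanSpace ℂ (Fin n)} :
    x ∈ nullSpace A ↔ A *ᵥ x.ofLp = 0 := by
  simp [nullSpace]

theorem updateCol_mulVec_of_apply_eq_zero (G : Matrix (Fin n) (Fin p) ℂ) (i : Fin p)
    (v : Fin n → ℂ) {a : Fin p → ℂ} (ha : a i = 0) : G.updateCol i v *ᵥ a = G *ᵥ a := by
  ext k
  simp only [mulVec, dotProduct]
  refine Finset.sum_congr rfl fun j _ => ?_
  by_cases hj : j = i
  · simp [hj, ha]
  · simp [hj]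

theorem otherCols_updateCol (G : Matrix (Fin n) (Fin p) ℂ) (i : Fin p) (v : Fin n → ℂ) :
    otherCols (G.updateCol i v) i = otherCols G i := by
  ext x
  simp only [mem_otherCols]
  refine exists_congr fun a => and_congr_right fun ha => ?_
  rw [updateCol_mulVec_of_apply_eq_zero G i v ha]

theorem col_notMem_otherCols {G : Matrix (Fin n) (Fin p) ℂ} (hG : Function.Injective G.mulVec)
    (i : Fin p) : WithLp.toLp 2 (G.col i) ∉ otherCols G i := by
  rw [mem_otherCols]
  rintro ⟨a, ha, h⟩
  have h1 : G *ᵥ a = G *ᵥ Pi.single i 1 := by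
    rw [mulVec_single_one]
    exact WithLp.toLp_injective 2 h
  have := congrFun (hG h1) i
  simp [ha] at this

open scoped ComplexOrder in
theorem isUnit_conjTranspose_mul_self_iff {B : Matrix (Fin n) (Fin p) ℂ} :
    IsUnit (Bᴴ * B) ↔ Function.Injective B.mulVec := by
  constructor
  · intro h x y hxy
    refine Matrix.mulVec_injective_of_isUnit h ?_
    change B *ᵥ x = B *ᵥ y at hxy
    change (Bᴴ * B) *ᵥ x = (Bᴴ * B) *ᵥ y
    rw [← mulVec_mulVec, ← mulVec_mulVec, hxy]
  · intro h
    exact (Matrix.PosDef.conjTranspose_mul_self B h).isUnit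

/-- The diagonal entries of the inverse of a matrix, from a solution of a linear system. -/
theorem inv_apply_self_of_mulVec_eq {C : Matrix (Fin p) (Fin p) ℂ} (hC : IsUnit C) {i : Fin p}
    {a : Fin p → ℂ} {t : ℂ} (h : C *ᵥ a = t • Pi.single i 1) (ha : a i = 1) :
    C⁻¹ i i = t⁻¹ := by
  have h1 : a = t • (C⁻¹ *ᵥ Pi.single i 1) := by
    rw [← mulVec_smul, ← h, mulVec_mulVec,
      Matrix.nonsing_inv_mul _ ((Matrix.isUnit_iff_isUnit_det _).1 hC), one_mulVec]
  have h2 := congrFun h1 i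
  rw [ha, mulVec_single_one] at h2
  simp only [Pi.smul_apply, Matrix.col_apply, smul_eq_mul] at h2
  exact eq_inv_of_mul_eq_one_right h2.symm

theorem rowProj_conjTranspose (A : Matrix (Fin m) (Fin n) ℂ) : (rowProj A)ᴴ = rowProj A := by
  simp only [rowProj, conjTranspose_mul, conjTranspose_conjTranspose, conjTranspose_nonsing_inv,
    Matrix.mul_assoc]

theorem mul_rowProj {A : Matrix (Fin m) (Fin n) ℂ} (hA : IsUnit (A * Aᴴ)) : A * rowProj A = A := by
  rw [rowProj, ← Matrix.mul_assoc, ← Matrix.mul_assoc,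
    Matrix.mul_nonsing_inv _ ((Matrix.isUnit_iff_isUnit_det _).1 hA), Matrix.one_mul]

/-- The difference d = r - Pr lies in the null space, hence is orthogonal to r. It is also
orthogonal to Pr, since P is self-adjoint and Pd = 0. So d is orthogonal to itself. -/
theorem rowProj_mulVec_of_mem_orthogonal {A : Matrix (Fin m) (Fin n) ℂ} (hA : IsUnit (A * Aᴴ))
    {r : EuclideanSpace ℂ (Fin n)} (hr : r ∈ (nullSpace A)ᗮ) : rowProj A *ᵥ r.ofLp = r.ofLp := by
  set d : EuclideanSpace ℂ (Fin n) := r - WithLp.toLp 2 (rowProj A *ᵥ r.ofLp) with hd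
  have hdn : d ∈ nullSpace A := by
    rw [mem_nullSpace, hd, WithLp.ofLp_sub, mulVec_sub, mulVec_mulVec, mul_rowProj hA, sub_self]
  have h1 : inner ℂ d r = 0 := (Submodule.mem_orthogonal _ _).1 hr d hdn
  have h2 : inner ℂ d (WithLp.toLp 2 (rowProj A *ᵥ r.ofLp)) = 0 := by
    have hPd : rowProj A *ᵥ d.ofLp = 0 := by
      rw [rowProj, ← mulVec_mulVec, mem_nullSpace.1 hdn, mulVec_zero]
    rw [EuclideanSpace.inner_eq_star_dotProduct, dotProduct_comm, dotProduct_mulVec,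
      ← rowProj_conjTranspose, ← star_mulVec, hPd, star_zero, zero_dotProduct]
  have h3 : inner ℂ d d = 0 := by
    nth_rewrite 2 [hd]
    rw [inner_sub_right, h1, h2, sub_zero]
  rw [inner_self_eq_zero, hd, sub_eq_zero] at h3
  exact (congrArg WithLp.ofLp h3).symm

theorem rowProj_mulVec_eq_zero {A : Matrix (Fin m) (Fin n) ℂ} {x : EuclideanSpace ℂ (Fin n)}
    (hx : x ∈ nullSpace A) : rowProj A *ᵥ x.ofLp = 0 := by
  rw [mem_nullSpace] at hx
  rw [rowProj, ← mulVec_mulVec, hx, mulVec_zero]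

theorem isUnit_compressed_gram {A : Matrix (Fin m) (Fin n) ℂ} (hA : IsUnit (A * Aᴴ))
    {G : Matrix (Fin n) (Fin p) ℂ} (hG : Function.Injective (A * G).mulVec) :
    IsUnit ((rowProj A * G)ᴴ * (rowProj A * G)) := by
  rw [isUnit_conjTranspose_mul_self_iff]
  intro x y hxy
  refine hG ?_
  have := congrArg (A *ᵥ ·) hxy
  simpa only [mulVec_mulVec, ← Matrix.mul_assoc, mul_rowProj hA] using this

/-- Let r be the residual of the `i`-th column modulo `N`, and write the removed part as κ + Ga with
Aκ = 0 and a_i = 0. Then e_i - a solves a normal equation: P sends G(e_i - a) = r + κ to r, so the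
Gram matrix sends e_i - a to Gᴴr, which equals ‖r‖² e_i because r is orthogonal to the other
columns. -/
theorem compressed_gram_inv_apply_self {A : Matrix (Fin m) (Fin n) ℂ} (hA : IsUnit (A * Aᴴ))
    {G : Matrix (Fin n) (Fin p) ℂ} (hG : Function.Injective (A * G).mulVec) (i : Fin p) :
    ((rowProj A * G)ᴴ * (rowProj A * G))⁻¹ i i =
      ((‖(nullSpace A ⊔ otherCols G i)ᗮ.starProjection (WithLp.toLp 2 (G.col i))‖ ^ 2 : ℝ) : ℂ)⁻¹ := by
  set N := nullSpace A ⊔ otherCols G i with hN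
  set g : EuclideanSpace ℂ (Fin n) := WithLp.toLp 2 (G.col i) with hg
  set r := Nᗮ.starProjection g with hr
  have hrN : r ∈ Nᗮ := by simp [hr]
  have hsub : g - r ∈ N := by
    have := Nᗮ.sub_starProjection_mem_orthogonal g
    rwa [Submodule.orthogonal_orthogonal] at this
  obtain ⟨κ, hκ, s, hs, hκs⟩ := Submodule.mem_sup.1 hsub
  obtain ⟨a, ha, rfl⟩ := mem_otherCols.1 hs
  have hPr : rowProj A *ᵥ r.ofLp = r.ofLp :=
    rowProj_mulVec_of_mem_orthogonal hA (Submodule.orthogonal_le le_sup_left hrN)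
  have hGc : G *ᵥ (Pi.single i 1 - a) = r.ofLp + κ.ofLp := by
    have := congrArg WithLp.ofLp hκs
    simp only [WithLp.ofLp_add, WithLp.ofLp_sub, hg] at this
    rw [mulVec_sub, mulVec_single_one, sub_eq_iff_eq_add, add_assoc, this]
    abel
  refine inv_apply_self_of_mulVec_eq (isUnit_compressed_gram hA hG)
    (a := Pi.single i 1 - a) ?_ (by simp [ha])
  have hC : ((rowProj A * G)ᴴ * (rowProj A * G)) *ᵥ (Pi.single i 1 - a) = Gᴴ *ᵥ r.ofLp := by
    rw [← mulVec_mulVec, ← mulVec_mulVec, hGc, mulVec_add, rowProj_mulVec_eq_zero hκ, hPr, add_zero,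
      conjTranspose_mul, rowProj_conjTranspose, ← mulVec_mulVec, hPr]
  have hentry : ∀ j, (Gᴴ *ᵥ r.ofLp) j = inner ℂ (WithLp.toLp 2 (G.col j)) r := fun j => by
    rw [EuclideanSpace.inner_eq_star_dotProduct, dotProduct_comm]
    rfl
  rw [hC]
  ext j
  rw [hentry]
  by_cases hj : j = i
  · subst hj
    have h0 : inner ℂ (g - r) r = 0 := (Submodule.mem_orthogonal _ _).1 hrN _ hsub
    rw [inner_sub_left, sub_eq_zero] at h0
    rw [← hg, h0, inner_self_eq_norm_sq_to_K]
    simp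
  · have h0 : WithLp.toLp 2 (G.col j) ∈ N := by
      refine Submodule.mem_sup_right (mem_otherCols.2 ⟨Pi.single j 1, by simp [Ne.symm hj], ?_⟩)
      rw [mulVec_single_one]
    rw [(Submodule.mem_orthogonal _ _).1 hrN _ h0]
    simp [hj]

theorem gram_inv_apply_self {G : Matrix (Fin n) (Fin p) ℂ} (hG : Function.Injective G.mulVec)
    (i : Fin p) : (Gᴴ * G)⁻¹ i i =
      ((‖(otherCols G i)ᗮ.starProjection (WithLp.toLp 2 (G.col i))‖ ^ 2 : ℝ) : ℂ)⁻¹ := by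
  -- No compression is compression by the identity, whose null space is trivial.
  have h := compressed_gram_inv_apply_self (A := (1 : Matrix (Fin n) (Fin n) ℂ)) (G := G)
    (by simp) (by simpa using hG) i
  have h1 : rowProj (1 : Matrix (Fin n) (Fin n) ℂ) = 1 := by simp [rowProj]
  have h2 : nullSpace (1 : Matrix (Fin n) (Fin n) ℂ) = ⊥ := by
    ext x
    rw [mem_nullSpace, one_mulVec, Submodule.mem_bot, WithLp.ofLp_eq_zero]
  simpa only [h1, h2, Matrix.one_mul, bot_sup_eq] using h

theorem crbRatio_eq {A : Matrix (Fin m) (Fin n) ℂ} (hA : IsUnit (A * Aᴴ))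
    {G : Matrix (Fin n) (Fin p) ℂ} (hG : Function.Injective (A * G).mulVec) (i : Fin p) :
    crbRatio A G i = (((‖(nullSpace A ⊔ otherCols G i)ᗮ.starProjection
        (WithLp.toLp 2 (G.col i))‖ ^ 2 /
      ‖(otherCols G i)ᗮ.starProjection (WithLp.toLp 2 (G.col i))‖ ^ 2)⁻¹ : ℝ) : ℂ) := by
  have hG' : Function.Injective G.mulVec := fun x y hxy => hG (by
    simpa only [mulVec_mulVec] using congrArg (A *ᵥ ·) hxy)
  rw [crbRatio, compressed_gram_inv_apply_self hA hG, gram_inv_apply_self hG']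
  push_cast
  rw [inv_div, div_inv_eq_mul, mul_comm, div_eq_mul_inv]

/-- Replacing a column amounts, up to an invertible column operation, to a unitary map. -/
theorem exists_unitary_mul_eq_updateCol_mul (G : Matrix (Fin n) (Fin p) ℂ) (i : Fin p)
    (hq : WithLp.toLp 2 (G.col i) ∉ otherCols G i) {v : Fin n → ℂ}
    (hv : WithLp.toLp 2 v ∉ otherCols G i) :
    ∃ U ∈ Matrix.unitaryGroup (Fin n) ℂ, ∃ T : Matrix (Fin p) (Fin p) ℂ, IsUnit T ∧
      ∃ c : ℂ, c ≠ 0 ∧ T i = Pi.single i c ∧ U * G = G.updateCol i v * T := by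
  obtain ⟨U, hU, c, hc, hUq⟩ :=
    (otherCols G i).exists_isometry_fixing_map_sub_smul_mem hq hv
  obtain ⟨M, hM, hMU⟩ := U.exists_mem_unitaryGroup_mulVec
  obtain ⟨a, ha, hae⟩ := mem_otherCols.1 hUq
  have hMi : M *ᵥ G.col i = G *ᵥ a + c • v := by
    have : WithLp.toLp 2 (M *ᵥ G.col i) = WithLp.toLp 2 (G *ᵥ a + c • v) := by
      rw [hMU, WithLp.toLp_add, hae, WithLp.toLp_smul]
      abel
    exact WithLp.toLp_injective 2 this
  have hMj : ∀ j, j ≠ i → M *ᵥ G.col j = G.col j := fun j hj => by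
    refine WithLp.toLp_injective 2 ?_
    rw [hMU, hU]
    refine mem_otherCols.2 ⟨Pi.single j 1, by simp [Ne.symm hj], ?_⟩
    rw [mulVec_single_one]
  -- Only column `i` differs from the identity. Since a_i = 0, row `i` is c·e_i and the determinant
  -- is c, computed below by Cramer's rule.
  set T : Matrix (Fin p) (Fin p) ℂ := (1 : Matrix (Fin p) (Fin p) ℂ).updateCol i
    (a + Pi.single i c) with hT
  refine ⟨M, hM, T, ?_, c, hc, ?_, ?_⟩
  · rw [Matrix.isUnit_iff_isUnit_det, hT, ← Matrix.cramer_apply, Matrix.cramer_one]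
    simpa [ha] using hc
  · ext j
    by_cases hj : j = i
    · subst hj; simp [hT, ha]
    · simp [hT, hj, Ne.symm hj]
  · ext k j
    change (M *ᵥ G.col j) k = (G.updateCol i v *ᵥ T.col j) k
    by_cases hj : j = i
    · subst hj
      have : T.col j = a + Pi.single j c := by ext; simp [hT]
      rw [hMi, this, mulVec_add, updateCol_mulVec_of_apply_eq_zero G j v ha]
      simp [mulVec_single]
    · have : T.col j = Pi.single j 1 := by
        ext l
        simp [hT, hj, Matrix.one_apply, Pi.single_apply]
      rw [hMj j hj, this, mulVec_single_one]
      simp [hj]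

/-- Row `i` of `T⁻¹` is c⁻¹·e_i, so the (i,i) entry of T⁻¹C⁻¹T⁻ᴴ involves no entry of `C⁻¹` but the
(i,i) one. -/
theorem inv_apply_self_congr {C T : Matrix (Fin p) (Fin p) ℂ} {i : Fin p} (hT : IsUnit T) {c : ℂ}
    (hc : c ≠ 0) (hTi : T i = Pi.single i c) :
    (Tᴴ * C * T)⁻¹ i i = C⁻¹ i i / (c * star c) := by
  have hdet := (Matrix.isUnit_iff_isUnit_det _).1 hT
  have hrow : ∀ j, T⁻¹ i j = Pi.single (M := fun _ => ℂ) i c⁻¹ j := fun j => by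
    have h1 : (T * T⁻¹) i j = (1 : Matrix (Fin p) (Fin p) ℂ) i j := by
      rw [Matrix.mul_nonsing_inv _ hdet]
    rw [Matrix.mul_apply, hTi] at h1
    simp only [Pi.single_apply, ite_mul, zero_mul, Finset.sum_ite_eq', Finset.mem_univ,
      if_true, Matrix.one_apply] at h1
    rw [Pi.single_apply]
    split_ifs with hj
    · rw [if_pos hj.symm] at h1
      exact eq_inv_of_mul_eq_one_right h1
    · rw [if_neg (Ne.symm hj)] at h1
      exact (mul_eq_zero.1 h1).resolve_left hc
  rw [Matrix.mul_inv_rev, Matrix.mul_inv_rev, ← conjTranspose_nonsing_inv, Matrix.mul_apply]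
  simp only [hrow, Matrix.mul_apply, conjTranspose_apply, Pi.single_apply, ite_mul, zero_mul,
    Finset.sum_ite_eq', Finset.mem_univ, if_true, apply_ite star, star_zero, mul_ite, mul_zero]
  rw [star_inv₀]
  field_simp

/-- Multiplying `A` by `U` turns the projection P into UᴴPU, and the outer unitaries are absorbed by
`G`. -/
theorem crbRatio_mul_unitary (A : Matrix (Fin m) (Fin n) ℂ) (G : Matrix (Fin n) (Fin p) ℂ)
    (i : Fin p) {U : Matrix (Fin n) (Fin n) ℂ} (hU : U ∈ Matrix.unitaryGroup (Fin n) ℂ) :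
    crbRatio (A * U) G i = crbRatio A (U * G) i := by
  have h1 : U * Uᴴ = 1 := Matrix.mem_unitaryGroup_iff.1 hU
  have h2 : Uᴴ * U = 1 := Matrix.mem_unitaryGroup_iff'.1 hU
  have hP : rowProj (A * U) = Uᴴ * rowProj A * U := by
    rw [rowProj, rowProj, conjTranspose_mul]
    have : A * U * (Uᴴ * Aᴴ) = A * Aᴴ := by
      rw [Matrix.mul_assoc, ← Matrix.mul_assoc U, h1, Matrix.one_mul]
    rw [this]
    simp only [Matrix.mul_assoc]
  have e1 : (rowProj (A * U) * G)ᴴ * (rowProj (A * U) * G) =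
      (rowProj A * (U * G))ᴴ * (rowProj A * (U * G)) := by
    rw [hP]
    simp only [conjTranspose_mul, conjTranspose_conjTranspose, Matrix.mul_assoc]
    rw [← Matrix.mul_assoc U Uᴴ, h1, Matrix.one_mul]
  have e2 : (U * G)ᴴ * (U * G) = Gᴴ * G := by
    rw [conjTranspose_mul, Matrix.mul_assoc, ← Matrix.mul_assoc Uᴴ, h2, Matrix.one_mul]
  rw [crbRatio, crbRatio, e1, e2]

theorem crbRatio_mul_right (A : Matrix (Fin m) (Fin n) ℂ) (G : Matrix (Fin n) (Fin p) ℂ)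
    {i : Fin p} {T : Matrix (Fin p) (Fin p) ℂ} (hT : IsUnit T) {c : ℂ} (hc : c ≠ 0)
    (hTi : T i = Pi.single i c) : crbRatio A (G * T) i = crbRatio A G i := by
  have e1 : (rowProj A * (G * T))ᴴ * (rowProj A * (G * T)) =
      Tᴴ * ((rowProj A * G)ᴴ * (rowProj A * G)) * T := by
    simp only [conjTranspose_mul, Matrix.mul_assoc]
  have e2 : (G * T)ᴴ * (G * T) = Tᴴ * (Gᴴ * G) * T := by
    simp only [conjTranspose_mul, Matrix.mul_assoc]
  have hcc : c * star c ≠ 0 := mul_ne_zero hc (star_ne_zero.2 hc)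
  rw [crbRatio, crbRatio, e1, e2, inv_apply_self_congr hT hc hTi, inv_apply_self_congr hT hc hTi,
    div_div_div_cancel_right₀ hcc]

end Algebra

/-! ### Dimension counts and generic position -/

section Dimension

variable {m n p : ℕ}

theorem finrank_otherCols_add_one {G : Matrix (Fin n) (Fin p) ℂ}
    (hG : Function.Injective G.mulVec) (i : Fin p) :
    Module.finrank ℂ (otherCols G i) + 1 = p := by
  rw [otherCols, ← (Submodule.equivMapOfInjective _ ?_ _).finrank_eq]
  · have h := LinearMap.finrank_range_add_finrank_ker
      (LinearMap.proj i : (Fin p → ℂ) →ₗ[ℂ] ℂ)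
    rw [LinearMap.range_eq_top.2 (LinearMap.proj_surjective i), finrank_top, Module.finrank_self,
      Module.finrank_fin_fun] at h
    omega
  · exact (WithLp.linearEquiv 2 ℂ (Fin n → ℂ)).symm.injective.comp hG

theorem mulVec_surjective {A : Matrix (Fin m) (Fin n) ℂ} (hA : IsUnit (A * Aᴴ)) :
    Function.Surjective A.mulVec := fun y =>
  ⟨Aᴴ *ᵥ ((A * Aᴴ)⁻¹ *ᵥ y), by
    rw [mulVec_mulVec, mulVec_mulVec,
      Matrix.mul_nonsing_inv _ ((Matrix.isUnit_iff_isUnit_det _).1 hA), one_mulVec]⟩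

theorem finrank_nullSpace_add {A : Matrix (Fin m) (Fin n) ℂ} (hA : IsUnit (A * Aᴴ)) :
    Module.finrank ℂ (nullSpace A) + m = n := by
  have h := LinearMap.finrank_range_add_finrank_ker
    (A.mulVecLin ∘ₗ (WithLp.linearEquiv 2 ℂ (Fin n → ℂ)).toLinearMap)
  rw [LinearMap.range_eq_top.2, finrank_top, Module.finrank_fin_fun, finrank_euclideanSpace_fin]
    at h
  · exact (add_comm _ _).trans h
  · exact (mulVec_surjective hA).comp (WithLp.linearEquiv 2 ℂ (Fin n → ℂ)).surjective

/-- Injectivity of `A * G` makes the two subspaces meet trivially, so their dimensions n - m and p -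
1 add up. -/
theorem finrank_sup_add_one {A : Matrix (Fin m) (Fin n) ℂ} (hA : IsUnit (A * Aᴴ))
    {G : Matrix (Fin n) (Fin p) ℂ} (hG : Function.Injective (A * G).mulVec) (i : Fin p) :
    Module.finrank ℂ ↥(nullSpace A ⊔ otherCols G i) + m + 1 = n + p := by
  have hG' : Function.Injective G.mulVec := fun x y hxy => hG (by
    simpa only [mulVec_mulVec] using congrArg (A *ᵥ ·) hxy)
  have hdisj : nullSpace A ⊓ otherCols G i = ⊥ := by
    rw [eq_bot_iff]
    rintro x ⟨hx, hx'⟩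
    obtain ⟨a, ha, rfl⟩ := mem_otherCols.1 hx'
    have h0 : (A * G) *ᵥ a = (A * G) *ᵥ 0 := by
      rw [mulVec_zero, ← mulVec_mulVec]
      exact mem_nullSpace.1 hx
    rw [hG h0, mulVec_zero]
    simp
  have h := Submodule.finrank_sup_add_finrank_inf_eq (nullSpace A) (otherCols G i)
  rw [hdisj, finrank_bot] at h
  have h1 := finrank_otherCols_add_one hG' i
  have h2 := finrank_nullSpace_add hA
  omega

/-- A kernel vector with nonzero `i`-th coordinate would express v through the null space and the
other columns. The hypothesis on `G` ignores column `i`, which lets the lemma serve as an induction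
step on columns. -/
theorem injective_mul_updateCol {A : Matrix (Fin m) (Fin n) ℂ}
    {G : Matrix (Fin n) (Fin p) ℂ} {i : Fin p}
    (hG : ∀ a : Fin p → ℂ, a i = 0 → A *ᵥ (G *ᵥ a) = 0 → a = 0) {v : Fin n → ℂ}
    (hv : WithLp.toLp 2 v ∉ nullSpace A ⊔ otherCols G i) :
    Function.Injective (A * G.updateCol i v).mulVec := by
  refine (injective_iff_map_eq_zero (A * G.updateCol i v).mulVecLin).2 fun a ha => ?_
  set b : Fin p → ℂ := a - Pi.single i (a i) with hb
  have hbi : b i = 0 := by simp [hb]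
  have hab : a = b + Pi.single i (a i) := by simp [hb]
  have hGa : G.updateCol i v *ᵥ a = G *ᵥ b + a i • v := by
    conv_lhs => rw [hab]
    rw [mulVec_add, updateCol_mulVec_of_apply_eq_zero G i v hbi]
    congr 1
    ext k
    simp [mulVec_single, mul_comm]
  rw [mulVecLin_apply, ← mulVec_mulVec, hGa] at ha
  by_cases hai : a i = 0
  · rw [hab, hai, Pi.single_zero, add_zero]
    refine hG b hbi ?_
    simpa [hai] using ha
  · refine absurd ?_ hv
    have : WithLp.toLp 2 v = (a i)⁻¹ • (WithLp.toLp 2 (G *ᵥ b + a i • v) -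
        WithLp.toLp 2 (G *ᵥ b)) := by
      rw [← WithLp.toLp_sub, add_sub_cancel_left, WithLp.toLp_smul, smul_smul,
        inv_mul_cancel₀ hai, one_smul]
    rw [this]
    refine Submodule.smul_mem _ _ (Submodule.sub_mem _ (Submodule.mem_sup_left ?_)
      (Submodule.mem_sup_right (mem_otherCols.2 ⟨b, hbi, rfl⟩)))
    exact mem_nullSpace.2 ha

end Dimension

theorem Submodule.ae_notMem_of_ne_top {V : Type*} [NormedAddCommGroup V] [NormedSpace ℂ V]
    [FiniteDimensional ℂ V] [MeasurableSpace V] [BorelSpace V] (μ : Measure V)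
    [μ.IsAddHaarMeasure] {W : Submodule ℂ V} (hW : W ≠ ⊤) : ∀ᵐ v ∂μ, v ∉ W := by
  have h : W.restrictScalars ℝ ≠ ⊤ := fun h => hW (by
    rwa [Submodule.restrictScalars_eq_top_iff] at h)
  have := Measure.addHaar_submodule μ (W.restrictScalars ℝ) h
  rw [ae_iff]
  simpa using this

theorem Submodule.coe_starProjection_comap_subtype {V : Type*} [NormedAddCommGroup V]
    [InnerProductSpace ℂ V] [FiniteDimensional ℂ V] {K M : Submodule ℂ V} (hKM : K ≤ M) (v : M) :
    (((K.comap M.subtype).starProjection v : M) : V) = K.starProjection (v : V) := by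
  symm
  refine Submodule.eq_starProjection_of_mem_of_inner_eq_zero
    ((K.comap M.subtype).starProjection_apply_mem v) fun w hw => ?_
  have h := (K.comap M.subtype).sub_starProjection_mem_orthogonal v
  exact (Submodule.mem_orthogonal' _ _).1 h ⟨w, hKM hw⟩ hw

/-- For v in `Sᗮ` the projection off `S` does nothing, so the ratio is the inverse squared cosine of
the angle between v and `K`, the subspace `Nᗮ` viewed inside `M`. The Beta parameters are dim K and
the dimension of its complement in `M`. -/
theorem setLIntegral_ball_crbRatio {m n p : ℕ} (hpm : p ≤ m) (hmn : m + p ≤ n)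
    {A : Matrix (Fin m) (Fin n) ℂ} (hA : IsUnit (A * Aᴴ)) {G : Matrix (Fin n) (Fin p) ℂ}
    (hG : Function.Injective (A * G).mulVec) (i : Fin p)
    {M : Submodule ℂ (EuclideanSpace ℂ (Fin n))} (hM : M = (otherCols G i)ᗮ)
    (μ : Measure M) [μ.IsAddHaarMeasure] (h : ℂ → ℝ≥0∞) (hh : Measurable h) :
    ∫⁻ v in Metric.ball 0 1, h (crbRatio A (G.updateCol i (v : EuclideanSpace ℂ (Fin n)).ofLp) i) ∂μ
      = μ (Metric.ball 0 1) *
        ∫⁻ u, h ((u⁻¹ : ℝ) : ℂ) ∂betaMeasure ((m : ℝ) - p + 1) ((n : ℝ) - m) := by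
  have hp : 0 < p := i.pos
  set N := nullSpace A ⊔ otherCols G i with hN
  have hNM : Nᗮ ≤ M := hM ▸ Submodule.orthogonal_le le_sup_right
  set K : Submodule ℂ M := Nᗮ.comap M.subtype with hK
  have hG' : Function.Injective G.mulVec := fun x y hxy => hG (by
    simpa only [mulVec_mulVec] using congrArg (A *ᵥ ·) hxy)
  have hKN : Module.finrank ℂ K = Module.finrank ℂ ↥Nᗮ :=
    (Submodule.comapSubtypeEquivOfLe hNM).finrank_eq
  have d1 := finrank_sup_add_one hA hG i
  have d2 := finrank_otherCols_add_one hG' i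
  have d3 := N.finrank_add_finrank_orthogonal
  have d4 := (otherCols G i).finrank_add_finrank_orthogonal
  have d5 := Submodule.finrank_add_finrank_orthogonal (𝕜 := ℂ) (E := M) K
  rw [finrank_euclideanSpace_fin] at d3 d4
  rw [← hN] at d1
  rw [← hM] at d4
  have hk : Module.finrank ℂ K + p = m + 1 := by omega
  have hl : Module.finrank ℂ (Submodule.orthogonal (𝕜 := ℂ) (E := M) K) + m = n := by omega
  have hk' : (Module.finrank ℂ K : ℝ) = (m : ℝ) - p + 1 := by
    have : (Module.finrank ℂ K : ℝ) + p = m + 1 := by exact_mod_cast hk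
    linarith
  have hl' : (Module.finrank ℂ (Submodule.orthogonal (𝕜 := ℂ) (E := M) K) : ℝ) = (n : ℝ) - m := by
    have : (Module.finrank ℂ (Submodule.orthogonal (𝕜 := ℂ) (E := M) K) : ℝ) + m = n := by exact_mod_cast hl
    linarith
  rw [← hk', ← hl', ← setLIntegral_ball_starProjection_beta μ K (by omega) (by omega)
    (fun u => h ((u⁻¹ : ℝ) : ℂ)) (by fun_prop)]
  -- Otherwise Nᗮ ≤ M ≤ N, so Nᗮ = 0, contradicting dim K = m - p + 1 > 0. Hence almost every v lies
  -- outside `N`, and `crbRatio_eq` applies.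
  have htop : N.comap M.subtype ≠ ⊤ := by
    intro htop
    have hMN : M ≤ N := Submodule.comap_subtype_eq_top.1 htop
    have h0 : Nᗮ = ⊥ := by
      rw [eq_bot_iff]
      intro x hx
      have : inner ℂ x x = 0 := (Submodule.mem_orthogonal _ _).1 hx x (hMN (hNM hx))
      simpa using this
    rw [h0, finrank_bot] at hKN
    omega
  refine lintegral_congr_ae (ae_restrict_of_ae ?_)
  filter_upwards [Submodule.ae_notMem_of_ne_top μ htop] with v hv
  have hinj : Function.Injective
      (A * G.updateCol i (v : EuclideanSpace ℂ (Fin n)).ofLp).mulVec := by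
    refine injective_mul_updateCol (fun a _ ha => hG ?_) hv
    rw [mulVec_zero, ← mulVec_mulVec, ha]
  have hcol : (G.updateCol i (v : EuclideanSpace ℂ (Fin n)).ofLp).col i =
      (v : EuclideanSpace ℂ (Fin n)).ofLp := by
    ext; simp
  have hfix : (otherCols G i)ᗮ.starProjection (v : EuclideanSpace ℂ (Fin n)) = v :=
    Submodule.starProjection_eq_self_iff.2 (hM ▸ v.2)
  have hK' := Submodule.coe_starProjection_comap_subtype hNM v
  rw [crbRatio_eq hA hinj, otherCols_updateCol, hcol, WithLp.toLp_ofLp, hfix]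
  change h ((‖Nᗮ.starProjection (v : EuclideanSpace ℂ (Fin n))‖ ^ 2 / _ : ℝ)⁻¹ : ℝ) = _
  rw [← hK']
  rfl

/-! ### Measurability of matrix operations -/

section Measurability

variable {m n p : ℕ}

theorem Measurable.matrix_mul {Ω : Type*} [MeasurableSpace Ω] {M : Ω → Matrix (Fin m) (Fin n) ℂ}
    {N : Ω → Matrix (Fin n) (Fin p) ℂ} (hM : ∀ k l, Measurable fun ω => M ω k l)
    (hN : ∀ k l, Measurable fun ω => N ω k l) (k : Fin m) (l : Fin p) :
    Measurable fun ω => (M ω * N ω) k l := by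
  simp only [Matrix.mul_apply]
  exact Finset.measurable_sum _ fun j _ => (hM k j).mul (hN j l)

theorem Measurable.matrix_conjTranspose {Ω : Type*} [MeasurableSpace Ω]
    {M : Ω → Matrix (Fin m) (Fin n) ℂ} (hM : ∀ k l, Measurable fun ω => M ω k l)
    (k : Fin n) (l : Fin m) : Measurable fun ω => (M ω)ᴴ k l := by
  simp only [conjTranspose_apply]
  exact continuous_star.measurable.comp (hM l k)

/-- The inverse is det⁻¹ times the adjugate, also at singular matrices by the convention 0⁻¹ = 0, so
no invertibility is needed. -/
theorem Measurable.matrix_inv {Ω : Type*} [MeasurableSpace Ω] {M : Ω → Matrix (Fin p) (Fin p) ℂ}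
    (hM : ∀ k l, Measurable fun ω => M ω k l) (k l : Fin p) :
    Measurable fun ω => (M ω)⁻¹ k l := by
  have hM' : Measurable fun ω k l => M ω k l :=
    measurable_pi_lambda _ fun k => measurable_pi_lambda _ fun l => hM k l
  have hdet : Continuous fun A : Fin p → Fin p → ℂ => (Matrix.of A).det :=
    Continuous.matrix_det continuous_id
  have hadj : Continuous fun A : Fin p → Fin p → ℂ => (Matrix.of A).adjugate k l :=
    (Continuous.matrix_adjugate (A := fun A : Matrix (Fin p) (Fin p) ℂ => A)
      continuous_id).matrix_elem k l
  simp only [Matrix.inv_def, Ring.inverse_eq_inv', Matrix.smul_apply, smul_eq_mul]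
  exact (hdet.measurable.comp hM').inv.mul (hadj.measurable.comp hM')

theorem Measurable.crbRatio {Ω : Type*} [MeasurableSpace Ω] {A : Ω → Matrix (Fin m) (Fin n) ℂ}
    {G : Ω → Matrix (Fin n) (Fin p) ℂ} (hA : ∀ k l, Measurable fun ω => A ω k l)
    (hG : ∀ k l, Measurable fun ω => G ω k l) (i : Fin p) :
    Measurable fun ω => crbRatio (A ω) (G ω) i := by
  have hA' := Measurable.matrix_conjTranspose hA
  have hP := Measurable.matrix_mul (Measurable.matrix_mul hA'
    (Measurable.matrix_inv (Measurable.matrix_mul hA hA'))) hA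
  have hPG := Measurable.matrix_mul hP hG
  exact (Measurable.matrix_inv (Measurable.matrix_mul
    (Measurable.matrix_conjTranspose hPG) hPG) i i).div
    (Measurable.matrix_inv (Measurable.matrix_mul (Measurable.matrix_conjTranspose hG) hG) i i)

theorem Measurable.matrix_updateCol {Ω : Type*} [MeasurableSpace Ω] {v : Ω → Fin n → ℂ}
    (hv : Measurable v) (G : Matrix (Fin n) (Fin p) ℂ) (i : Fin p) (k : Fin n) (l : Fin p) :
    Measurable fun ω => G.updateCol i (v ω) k l := by
  by_cases h : l = i
  · subst h
    simpa [Function.comp_def] using (measurable_pi_apply k).comp hv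
  · simp [h]

theorem measurableSet_injective_mul {Ω : Type*} [MeasurableSpace Ω]
    {A : Ω → Matrix (Fin m) (Fin n) ℂ} {G : Ω → Matrix (Fin n) (Fin p) ℂ}
    (hA : ∀ k l, Measurable fun ω => A ω k l) (hG : ∀ k l, Measurable fun ω => G ω k l) :
    MeasurableSet {ω | Function.Injective (A ω * G ω).mulVec} := by
  have hAG := Measurable.matrix_mul hA hG
  have h := Measurable.matrix_mul (Measurable.matrix_conjTranspose hAG) hAG
  have hdet : Continuous fun A : Fin p → Fin p → ℂ => (Matrix.of A).det :=
    Continuous.matrix_det continuous_id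
  have h1 : Measurable fun ω => ((A ω * G ω)ᴴ * (A ω * G ω)).det :=
    hdet.measurable.comp
      (measurable_pi_lambda _ fun k => measurable_pi_lambda _ fun l => h k l)
  convert h1 (measurableSet_singleton (0 : ℂ)).compl using 1
  ext ω
  rw [Set.mem_ofPred_eq, ← isUnit_conjTranspose_mul_self_iff, Matrix.isUnit_iff_isUnit_det,
    isUnit_iff_ne_zero]
  rfl

theorem measurable_entry {X : Type*} [MeasurableSpace X] (k : Fin m) (l : Fin n) :
    Measurable fun A : Fin m → Fin n → X => A k l :=
  (measurable_pi_apply l).comp (measurable_pi_apply k)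

end Measurability

/-! ### Averaging over rotations -/

section Invariance

variable {m n p : ℕ}

/-- A measure on matrices is right-unitarily invariant. -/
def RightUnitarilyInvariant (P : Measure (Fin m → Fin n → ℂ)) : Prop :=
  ∀ U ∈ Matrix.unitaryGroup (Fin n) ℂ, P.map (fun A k l => (Matrix.of A * U) k l) = P

theorem measurable_mul_right (U : Matrix (Fin n) (Fin p) ℂ) :
    Measurable fun (A : Fin m → Fin n → ℂ) k l => (Matrix.of A * U) k l :=
  measurable_pi_lambda _ fun k => measurable_pi_lambda _ fun l =>
    Measurable.matrix_mul (M := fun A : Fin m → Fin n → ℂ => Matrix.of A) (N := fun _ => U)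
      measurable_entry (fun _ _ => measurable_const) k l

/-- If a function of a right-unitarily invariant random matrix and a fixed parameter can, for almost
every `v`, be moved to the parameter `v` by a rotation, then its mean may be averaged over `v`. -/
theorem RightUnitarilyInvariant.lintegral_mul_measure_univ {P : Measure (Fin m → Fin n → ℂ)}
    [SFinite P] (hP : RightUnitarilyInvariant P) {V : Type*} [MeasurableSpace V] (ν : Measure V)
    [SFinite ν] {g : (Fin m → Fin n → ℂ) → ℝ≥0∞} (hg : Measurable g)
    {F : (Fin m → Fin n → ℂ) → V → ℝ≥0∞} (hF : Measurable (Function.uncurry F))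
    (h : ∀ᵐ v ∂ν, ∃ U ∈ Matrix.unitaryGroup (Fin n) ℂ,
      ∀ A, g (fun k l => (Matrix.of A * U) k l) = F A v) :
    (∫⁻ A, g A ∂P) * ν Set.univ = ∫⁻ A, ∫⁻ v, F A v ∂ν ∂P := by
  -- By Tonelli it suffices to fix v; the inner integral is then that of `g` after a rotation, which
  -- invariance removes.
  rw [lintegral_lintegral_swap hF.aemeasurable, ← lintegral_const]
  refine lintegral_congr_ae ?_
  filter_upwards [h] with v ⟨U, hU, hv⟩
  nth_rewrite 1 [← hP U hU]
  rw [lintegral_map hg (measurable_mul_right U)]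
  exact lintegral_congr hv

/-- Induction on columns. The indicator of failure is averaged over a replacement v for column 0;
given injectivity on the remaining columns, failure forces v into a proper subspace, a null set. -/
theorem RightUnitarilyInvariant.ae_injective_mul {P : Measure (Fin m → Fin n → ℂ)} [SFinite P]
    (hP : RightUnitarilyInvariant P) (hA : ∀ᵐ A ∂P, IsUnit (Matrix.of A * (Matrix.of A)ᴴ))
    (hpm : p ≤ m) (G : Matrix (Fin n) (Fin p) ℂ)
    (hG : Function.Injective G.mulVec) :
    ∀ᵐ A ∂P, Function.Injective (Matrix.of A * G).mulVec := by
  induction p with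
  | zero => exact .of_forall fun A => Function.injective_of_subsingleton _
  | succ p ih =>
    set G' : Matrix (Fin n) (Fin p) ℂ := G.submatrix id Fin.succ with hG'
    have htail : ∀ a : Fin p → ℂ, G' *ᵥ a = G *ᵥ (Fin.cons 0 a : Fin (p + 1) → ℂ) := fun a => by
      ext k
      simp [mulVec, dotProduct, Fin.sum_univ_succ, hG']
    have hG'inj : Function.Injective G'.mulVec := fun x y hxy => by
      change G' *ᵥ x = G' *ᵥ y at hxy
      rw [htail, htail] at hxy
      exact (Fin.cons_right_injective _ (hG hxy))
    have hih := ih (by omega) G' hG'inj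
    have hq := col_notMem_otherCols hG 0
    have hM : MeasurableSet {A : Fin m → Fin n → ℂ |
        Function.Injective (Matrix.of A * G).mulVec} :=
      measurableSet_injective_mul measurable_entry (fun _ _ => measurable_const)
    have hM2 : MeasurableSet {x : (Fin m → Fin n → ℂ) × (EuclideanSpace ℂ (Fin n)) |
        Function.Injective (Matrix.of x.1 * G.updateCol 0 x.2.ofLp).mulVec} :=
      measurableSet_injective_mul (fun k l => (measurable_entry k l).comp measurable_fst)
        (Measurable.matrix_updateCol (by fun_prop) G 0)
    have hdim := finrank_otherCols_add_one hG 0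
    have hne : otherCols G 0 ≠ ⊤ := fun htop => hq (htop ▸ Submodule.mem_top)
    set ν : Measure (EuclideanSpace ℂ (Fin n)) := Measure.addHaar with hν
    have key := hP.lintegral_mul_measure_univ ν
      (g := {A | Function.Injective (Matrix.of A * G).mulVec}ᶜ.indicator 1)
      (F := fun A v => {x : (Fin m → Fin n → ℂ) × (EuclideanSpace ℂ (Fin n)) |
        Function.Injective (Matrix.of x.1 * G.updateCol 0 x.2.ofLp).mulVec}ᶜ.indicator 1 (A, v))
      (measurable_one.indicator hM.compl) (measurable_one.indicator hM2.compl) (by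
        filter_upwards [Submodule.ae_notMem_of_ne_top ν hne] with v hv
        obtain ⟨U, hU, T, hT, c, hc, hTi, hUT⟩ :=
          exists_unitary_mul_eq_updateCol_mul G 0 hq (v := v.ofLp) hv
        refine ⟨U, hU, fun A => ?_⟩
        have e : (Matrix.of fun k l => (Matrix.of A * U) k l) * G =
            Matrix.of A * G.updateCol 0 v.ofLp * T := by
          rw [Matrix.mul_assoc (Matrix.of A) _ T, ← hUT, ← Matrix.mul_assoc]
          rfl
        have hiff : Function.Injective
            ((Matrix.of fun k l => (Matrix.of A * U) k l) * G).mulVec ↔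
            Function.Injective (Matrix.of A * G.updateCol 0 v.ofLp).mulVec := by
          rw [e, ← isUnit_conjTranspose_mul_self_iff, ← isUnit_conjTranspose_mul_self_iff]
          have hT' := (Matrix.isUnit_iff_isUnit_det _).1 hT
          rw [Matrix.isUnit_iff_isUnit_det, Matrix.isUnit_iff_isUnit_det, conjTranspose_mul,
            Matrix.mul_assoc, ← Matrix.mul_assoc _ _ T, det_mul, det_mul, det_conjTranspose]
          rw [IsUnit.mul_iff, IsUnit.mul_iff]
          exact ⟨fun h => h.2.1, fun h => ⟨hT'.star, h, hT'⟩⟩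
        classical
        simp only [Set.indicator_apply, Set.mem_compl_iff, Set.mem_ofPred_eq, hiff, Pi.one_apply])
    have hzero : ∫⁻ A, ∫⁻ v, {x : (Fin m → Fin n → ℂ) × (EuclideanSpace ℂ (Fin n)) |
        Function.Injective (Matrix.of x.1 * G.updateCol 0 x.2.ofLp).mulVec}ᶜ.indicator 1 (A, v) ∂ν ∂P
        = (0 : ℝ≥0∞) := by
      rw [← lintegral_zero (μ := P)]
      refine lintegral_congr_ae ?_
      filter_upwards [hA, hih] with A hA hAG'
      rw [← lintegral_zero (μ := ν)]
      -- The dimension is at most (n - m) + p, which is below n because p + 1 ≤ m.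
      have hne2 : nullSpace (Matrix.of A) ⊔ otherCols G 0 ≠ ⊤ := by
        intro htop
        have h1 := Submodule.finrank_add_le_finrank_add_finrank (nullSpace (Matrix.of A))
          (otherCols G 0)
        rw [htop, finrank_top, finrank_euclideanSpace_fin] at h1
        have h2 := finrank_nullSpace_add hA
        omega
      refine lintegral_congr_ae ?_
      filter_upwards [Submodule.ae_notMem_of_ne_top ν hne2] with v hv
      refine Set.indicator_of_notMem (Set.notMem_compl_iff.2 ?_) _
      change Function.Injective (Matrix.of A * G.updateCol 0 v.ofLp).mulVec
      refine injective_mul_updateCol (fun a ha hAa => ?_) hv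
      have hcons : a = Fin.cons 0 (Fin.tail a) := by
        rw [← ha, Fin.cons_self_tail]
      have h0 : (Matrix.of A * G') *ᵥ Fin.tail a = (Matrix.of A * G') *ᵥ 0 := by
        rw [mulVec_zero, ← mulVec_mulVec, htail, ← hcons, hAa]
      rw [hcons, hAG' h0]
      ext j
      refine Fin.cases ?_ (fun j => ?_) j <;> simp
    rw [hzero, mul_eq_zero] at key
    have hν0 : ν Set.univ ≠ 0 := isOpen_univ.measure_ne_zero ν Set.univ_nonempty
    have := (lintegral_eq_zero_iff (measurable_one.indicator hM.compl)).1
      (key.resolve_right hν0)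
    filter_upwards [this] with A hA0
    by_contra hcon
    simp [hcon] at hA0

/-- For a right-unitarily invariant random matrix of full row rank, the ratio of the Cramér–Rao
bounds is the inverse of a Beta variable. -/
theorem RightUnitarilyInvariant.map_crbRatio {P : Measure (Fin m → Fin n → ℂ)}
    [IsProbabilityMeasure P]
    (hP : RightUnitarilyInvariant P) (hA : ∀ᵐ A ∂P, IsUnit (Matrix.of A * (Matrix.of A)ᴴ))
    (hpm : p ≤ m) (hmn : m + p ≤ n) (G : Matrix (Fin n) (Fin p) ℂ)
    (hG : Function.Injective G.mulVec) (i : Fin p) :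
    P.map (fun A => crbRatio (Matrix.of A) G i) =
      (betaMeasure ((m : ℝ) - p + 1) ((n : ℝ) - m)).map fun b : ℝ => ((b⁻¹ : ℝ) : ℂ) := by
  have hmeas : Measurable fun A : Fin m → Fin n → ℂ => crbRatio (Matrix.of A) G i :=
    Measurable.crbRatio (A := fun A : Fin m → Fin n → ℂ => Matrix.of A) (G := fun _ => G)
      measurable_entry (fun _ _ => measurable_const) i
  have hq := col_notMem_otherCols hG i
  obtain ⟨M, hM⟩ : ∃ M, M = (otherCols G i)ᗮ := ⟨_, rfl⟩
  set μ : Measure M := Measure.addHaar with hμ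
  have hne : (otherCols G i).comap M.subtype ≠ ⊤ := by
    intro htop
    have h1 : M ≤ otherCols G i := Submodule.comap_subtype_eq_top.1 htop
    have h2 : (otherCols G i)ᗮ = ⊥ := by
      rw [eq_bot_iff]
      intro x hx
      have : inner ℂ x x = 0 := (Submodule.mem_orthogonal _ _).1 hx x (h1 (hM ▸ hx))
      simpa using this
    rw [Submodule.orthogonal_eq_bot_iff] at h2
    exact hq (h2 ▸ Submodule.mem_top)
  have hinv : Measurable fun b : ℝ => ((b⁻¹ : ℝ) : ℂ) :=
    Complex.measurable_ofReal.comp measurable_inv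
  ext s hs
  rw [Measure.map_apply hmeas hs, Measure.map_apply hinv hs,
    ← lintegral_indicator_one (hmeas hs), ← lintegral_indicator_one (hinv hs)]
  have hmeas2 : Measurable fun x : (Fin m → Fin n → ℂ) × M =>
      crbRatio (Matrix.of x.1) (G.updateCol i (x.2 : EuclideanSpace ℂ (Fin n)).ofLp) i :=
    Measurable.crbRatio (A := fun x : (Fin m → Fin n → ℂ) × M => Matrix.of x.1)
      (G := fun x => G.updateCol i (x.2 : EuclideanSpace ℂ (Fin n)).ofLp) (fun k l => (measurable_entry k l).comp measurable_fst)
      (Measurable.matrix_updateCol (by fun_prop) G i) i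
  have hind : Measurable (s.indicator (1 : ℂ → ℝ≥0∞)) := measurable_one.indicator hs
  -- Restricting to the unit ball gives a positive finite total mass, which is cancelled at the end.
  have key := hP.lintegral_mul_measure_univ (μ.restrict (Metric.ball 0 1))
    (g := fun A => s.indicator 1 (crbRatio (Matrix.of A) G i))
    (F := fun A v => s.indicator 1
      (crbRatio (Matrix.of A) (G.updateCol i (v : EuclideanSpace ℂ (Fin n)).ofLp) i))
    (hind.comp hmeas) (hind.comp hmeas2) (by
      filter_upwards [ae_restrict_of_ae (Submodule.ae_notMem_of_ne_top μ hne)] with v hv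
      obtain ⟨U, hU, T, hT, c, hc, hTi, hUT⟩ := exists_unitary_mul_eq_updateCol_mul G i hq
        (v := (v : EuclideanSpace ℂ (Fin n)).ofLp) hv
      refine ⟨U, hU, fun A => ?_⟩
      have e : crbRatio (Matrix.of A * U) G i =
          crbRatio (Matrix.of A) (G.updateCol i (v : EuclideanSpace ℂ (Fin n)).ofLp) i := by
        rw [crbRatio_mul_unitary _ _ _ hU, hUT, crbRatio_mul_right _ _ hT hc hTi]
      exact congrArg (s.indicator 1) e)
  have hconst : ∫⁻ A, ∫⁻ v in Metric.ball 0 1, s.indicator 1 (crbRatio (Matrix.of A)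
      (G.updateCol i (v : EuclideanSpace ℂ (Fin n)).ofLp) i) ∂μ ∂P = μ (Metric.ball 0 1) *
        ∫⁻ u, s.indicator 1 ((u⁻¹ : ℝ) : ℂ) ∂betaMeasure ((m : ℝ) - p + 1) ((n : ℝ) - m) := by
    rw [← mul_one (μ _ * _), ← measure_univ (μ := P), ← lintegral_const]
    refine lintegral_congr_ae ?_
    filter_upwards [hA, hP.ae_injective_mul hA hpm G hG] with A hA hAG
    exact setLIntegral_ball_crbRatio hpm hmn hA hAG i hM μ _ hind
  rw [hconst, Measure.restrict_apply_univ, mul_comm] at key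
  exact (ENNReal.mul_right_inj (Metric.measure_ball_pos μ 0 one_pos).ne'
    measure_ball_lt_top.ne).1 key

end Invariance

/-! ### Gaussian entries have a Gram density -/

section ProductDensity

theorem lintegral_pi_prod {n : ℕ} {X : Type*} [MeasurableSpace X] (μ : Fin n → Measure X)
    [∀ i, SigmaFinite (μ i)] (f : X → ℝ≥0∞) (hf : Measurable f) :
    ∫⁻ x, ∏ i, f (x i) ∂Measure.pi μ = ∏ i, ∫⁻ x, f x ∂μ i := by
  induction n with
  | zero => simp
  | succ n ih =>
    have h := (measurePreserving_piFinSuccAbove μ 0).lintegral_comp_emb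
      (MeasurableEquiv.measurableEmbedding _) (fun z => f z.1 * ∏ i, f (z.2 i))
    have h2 := lintegral_prod_mul (μ := μ 0) (ν := Measure.pi fun j : Fin n => μ j.succ)
      (f := f) (g := fun z => ∏ i, f (z i)) hf.aemeasurable
      (Finset.measurable_prod _ fun i _ => hf.comp (measurable_pi_apply i)).aemeasurable
    rw [Fin.prod_univ_succ, ← ih, ← h2]
    refine Eq.trans (lintegral_congr fun x => ?_) h
    rw [Fin.prod_univ_succ]
    rfl

theorem pi_withDensity {n : ℕ} {X : Type*} [MeasurableSpace X] (μ : Measure X)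
    [SigmaFinite μ] (f : X → ℝ≥0∞) (hf : Measurable f) [SigmaFinite (μ.withDensity f)] :
    Measure.pi (fun _ : Fin n => μ.withDensity f) =
      (Measure.pi fun _ : Fin n => μ).withDensity fun x => ∏ i, f (x i) := by
  refine Measure.pi_eq fun s hs => ?_
  rw [withDensity_apply _ (MeasurableSet.univ_pi hs), Measure.restrict_pi_pi,
    lintegral_pi_prod _ f hf]
  exact Finset.prod_congr rfl fun i _ => (withDensity_apply _ (hs i)).symm

theorem re_trace_mul_conjTranspose {m n : ℕ} (A : Fin m → Fin n → ℂ) :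
    (Matrix.of A * (Matrix.of A)ᴴ).trace.re = ∑ k, ∑ l, ‖A k l‖ ^ 2 := by
  simp only [Matrix.trace, Matrix.diag_apply, Matrix.mul_apply, conjTranspose_apply,
    Matrix.of_apply, Complex.re_sum, ← starRingEnd_apply, Complex.mul_conj,
    Complex.ofReal_re, Complex.normSq_eq_norm_sq]

theorem IsIIDComplexNormal.hasGramDensity {Ω : Type*} [MeasurableSpace Ω] {μ : Measure Ω}
    [IsProbabilityMeasure μ] {m n : ℕ} (hm : 0 < m) (hn : 0 < n)
    {Φ : Ω → Matrix (Fin m) (Fin n) ℂ} (h : IsIIDComplexNormal μ Φ) : HasGramDensity μ Φ := by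
  obtain ⟨hind, hlaw⟩ := h
  -- The total mass is 1 because this measure is the law of an entry; hence the need for at least
  -- one entry.
  have hprob : IsProbabilityMeasure stdComplexNormal := by
    rw [← (hlaw ⟨0, hm⟩ ⟨0, hn⟩).map_eq]
    exact Measure.isProbabilityMeasure_map (hlaw ⟨0, hm⟩ ⟨0, hn⟩).aemeasurable
  set f : ℂ → ℝ≥0∞ := fun z => ENNReal.ofReal (Real.exp (-‖z‖ ^ 2) / Real.pi) with hf
  have hfm : Measurable f := by fun_prop
  have hstd : stdComplexNormal = volume.withDensity f := rfl
  have hprob' : IsProbabilityMeasure (volume.withDensity f) := hprob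
  -- The sum of the squared moduli of the entries is the trace of the Gram matrix, so the product
  -- density depends on that matrix alone.
  have hgram : ∀ A : Fin m → Fin n → ℂ, ENNReal.ofReal
      (Real.exp (-(Matrix.of A * (Matrix.of A)ᴴ).trace.re) / Real.pi ^ (m * n)) =
      ∏ k, ∏ l, f (A k l) := fun A => by
    simp only [hf]
    rw [Finset.prod_congr rfl fun k _ =>
        (ENNReal.ofReal_prod_of_nonneg fun l _ => by positivity).symm,
      ← ENNReal.ofReal_prod_of_nonneg fun k _ => by positivity, re_trace_mul_conjTranspose]
    congr 1
    simp only [Finset.prod_div_distrib, ← Real.exp_sum, Finset.prod_const, Finset.card_univ,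
      Fintype.card_fin, Finset.sum_neg_distrib, ← pow_mul, mul_comm]
  refine ⟨fun S => ENNReal.ofReal (Real.exp (-S.trace.re) / Real.pi ^ (m * n)), ?_, ?_, ?_⟩
  · simp only [hgram]
    exact Finset.measurable_prod _ fun k _ => Finset.measurable_prod _ fun l _ =>
      hfm.comp (measurable_entry k l)
  · exact aemeasurable_pi_lambda _ fun k => aemeasurable_pi_lambda _ fun l =>
      (hlaw k l).aemeasurable
  · simp only [hgram]
    have h1 := hind.map_fun_eq_pi_map fun ij : Fin m × Fin n => (hlaw ij.1 ij.2).aemeasurable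
    simp only [(hlaw _ _).map_eq] at h1
    have h2 := Measure.infinitePi_map_curry (fun (_ : Fin m) (_ : Fin n) => stdComplexNormal)
    simp only [Measure.infinitePi_eq_pi] at h2
    have hae : AEMeasurable (fun ω (ij : Fin m × Fin n) => Φ ω ij.1 ij.2) μ :=
      aemeasurable_pi_lambda _ fun ij => (hlaw ij.1 ij.2).aemeasurable
    rw [← h1, AEMeasurable.map_map_of_aemeasurable
      (MeasurableEquiv.curry (Fin m) (Fin n) ℂ).measurable.aemeasurable hae] at h2
    refine Eq.trans h2 ?_
    rw [hstd, pi_withDensity _ f hfm]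
    have hprob2 : IsProbabilityMeasure ((Measure.pi fun _ : Fin n => (volume : Measure ℂ)).withDensity
        fun x => ∏ i, f (x i)) := by
      rw [← pi_withDensity _ f hfm]; infer_instance
    rw [pi_withDensity _ (fun x : Fin n → ℂ => ∏ i, f (x i))
      (Finset.measurable_prod _ fun i _ => hfm.comp (measurable_pi_apply i))]
    rfl

end ProductDensity

/-! ### Invariance of Lebesgue measure and generic full rank -/

section Lebesgue

variable {m n : ℕ}

theorem mul_unitary_mul_conjTranspose (A : Matrix (Fin m) (Fin n) ℂ)
    {U : Matrix (Fin n) (Fin n) ℂ} (hU : U ∈ Matrix.unitaryGroup (Fin n) ℂ) :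
    (A * U) * (A * U)ᴴ = A * Aᴴ := by
  have h1 : U * Uᴴ = 1 := Matrix.mem_unitaryGroup_iff.1 hU
  rw [conjTranspose_mul, Matrix.mul_assoc, ← Matrix.mul_assoc U, h1, Matrix.one_mul]

/-- The image of Lebesgue measure under a linear automorphism is a Haar measure, hence a multiple of
it. The factor is 1 because the Frobenius unit ball is preserved and has positive finite volume. -/
theorem rightUnitarilyInvariant_volume :
    RightUnitarilyInvariant (volume : Measure (Fin m → Fin n → ℂ)) := by
  intro U hU
  have h1 : U * Uᴴ = 1 := Matrix.mem_unitaryGroup_iff.1 hU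
  have h2 : Uᴴ * U = 1 := Matrix.mem_unitaryGroup_iff'.1 hU
  let e : (Fin m → Fin n → ℂ) ≃ₗ[ℝ] (Fin m → Fin n → ℂ) :=
    { toFun := fun A k l => (Matrix.of A * U) k l
      invFun := fun A k l => (Matrix.of A * Uᴴ) k l
      map_add' := fun A B => Matrix.add_mul (Matrix.of A) (Matrix.of B) U
      map_smul' := fun c A => Matrix.smul_mul c (Matrix.of A) U
      left_inv := fun A => by
        change Matrix.of A * U * Uᴴ = A
        rw [Matrix.mul_assoc, h1, Matrix.mul_one]; rfl
      right_inv := fun A => by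
        change Matrix.of A * Uᴴ * U = A
        rw [Matrix.mul_assoc, h2, Matrix.mul_one]; rfl }
  have hpi : (volume : Measure (Fin m → Fin n → ℂ)).IsAddHaarMeasure :=
    Measure.pi.isAddHaarMeasure fun _ : Fin m => (volume : Measure (Fin n → ℂ))
  have hmap : ((volume : Measure (Fin m → Fin n → ℂ)).map
      e.toContinuousLinearEquiv).IsAddHaarMeasure :=
    e.toContinuousLinearEquiv.isAddHaarMeasure_map _
  have hsmul := Measure.isAddLeftInvariant_eq_smul
    ((volume : Measure (Fin m → Fin n → ℂ)).map e.toContinuousLinearEquiv) volume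
  set c := Measure.addHaarScalarFactor
    ((volume : Measure (Fin m → Fin n → ℂ)).map e.toContinuousLinearEquiv) volume
  -- The norm of this function space is the supremum norm, whose balls are not unitarily invariant;
  -- the Frobenius ball is written out instead.
  set B : Set (Fin m → Fin n → ℂ) := {A | ∑ k, ∑ l, ‖A k l‖ ^ 2 < 1} with hB
  have hBo : IsOpen B := isOpen_lt (by fun_prop) continuous_const
  have hB0 : volume B ≠ 0 := hBo.measure_ne_zero _ ⟨0, by simp [hB]⟩
  have hBt : volume B ≠ ∞ := by
    refine ((Metric.isBounded_closedBall (x := (0 : Fin m → Fin n → ℂ)) (r := 1)).subset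
      fun A hA => ?_).measure_lt_top.ne
    rw [mem_closedBall_zero_iff, pi_norm_le_iff_of_nonneg zero_le_one]
    intro k
    rw [pi_norm_le_iff_of_nonneg zero_le_one]
    intro l
    have hA : ∑ k, ∑ l, ‖A k l‖ ^ 2 < 1 := hA
    have h3 : ‖A k l‖ ^ 2 ≤ ∑ l, ‖A k l‖ ^ 2 :=
      Finset.single_le_sum (f := fun l => ‖A k l‖ ^ 2) (fun _ _ => by positivity)
        (Finset.mem_univ l)
    have h4 : ∑ l, ‖A k l‖ ^ 2 ≤ ∑ k, ∑ l, ‖A k l‖ ^ 2 :=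
      Finset.single_le_sum (f := fun k => ∑ l, ‖A k l‖ ^ 2)
        (fun _ _ => Finset.sum_nonneg fun _ _ => by positivity) (Finset.mem_univ k)
    have h5 : ‖A k l‖ ^ 2 ≤ 1 := by linarith
    exact (sq_le_one_iff₀ (norm_nonneg _)).1 h5
  have hpre : e.toContinuousLinearEquiv ⁻¹' B = B := by
    ext A
    have h3 := re_trace_mul_conjTranspose (e A)
    rw [show Matrix.of (e A) = Matrix.of A * U from rfl, mul_unitary_mul_conjTranspose _ hU,
      re_trace_mul_conjTranspose] at h3
    exact (iff_of_eq (congrArg (· < 1) h3)).symm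
  have hval := congrArg (fun ν : Measure (Fin m → Fin n → ℂ) => ν B) hsmul
  beta_reduce at hval
  rw [Measure.map_apply e.toContinuousLinearEquiv.continuous.measurable hBo.measurableSet, hpre,
    Measure.smul_apply, ENNReal.smul_def, smul_eq_mul] at hval
  have hc : (c : ℝ≥0∞) = 1 := by
    rw [← ENNReal.mul_left_inj hB0 hBt, one_mul, ← hval]
  have hc' : c = 1 := by exact_mod_cast hc
  rw [hc', one_smul] at hsmul
  exact hsmul

theorem RightUnitarilyInvariant.withDensity_gram {P : Measure (Fin m → Fin n → ℂ)}
    (hP : RightUnitarilyInvariant P) {g : Matrix (Fin m) (Fin m) ℂ → ℝ≥0∞}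
    (hg : Measurable fun A : Fin m → Fin n → ℂ => g (Matrix.of A * (Matrix.of A)ᴴ)) :
    RightUnitarilyInvariant
      (P.withDensity fun A => g (Matrix.of A * (Matrix.of A)ᴴ)) := by
  intro U hU
  ext s hs
  have hm := measurable_mul_right (m := m) U
  rw [Measure.map_apply hm hs, withDensity_apply _ (hm hs), withDensity_apply _ hs]
  nth_rewrite 2 [← hP U hU]
  rw [setLIntegral_map hs hg hm]
  refine lintegral_congr fun A => ?_
  rw [← mul_unitary_mul_conjTranspose (Matrix.of A) hU]
  rfl

theorem isUnit_mul_conjTranspose_self_iff {A : Matrix (Fin m) (Fin n) ℂ} :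
    IsUnit (A * Aᴴ) ↔ LinearIndependent ℂ A.row := by
  rw [← Matrix.vecMul_injective_iff]
  have h := isUnit_conjTranspose_mul_self_iff (B := Aᴴ)
  rw [conjTranspose_conjTranspose] at h
  rw [h]
  have hstar : ∀ x, Aᴴ *ᵥ x = star (star x ᵥ* A) := fun x => by
    rw [star_vecMul, star_star]
  constructor
  · intro hi x y hxy
    refine star_injective (hi ?_)
    simp only [hstar, star_star]
    exact congrArg star hxy
  · intro hi x y hxy
    simp only [hstar] at hxy
    exact star_injective (hi (star_injective hxy))

theorem measurableSet_isUnit_mul_conjTranspose :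
    MeasurableSet {A : Fin m → Fin n → ℂ | IsUnit (Matrix.of A * (Matrix.of A)ᴴ)} := by
  have h := measurableSet_injective_mul (A := fun A : Fin m → Fin n → ℂ => (1 : Matrix (Fin n) (Fin n) ℂ))
    (G := fun A => (Matrix.of A)ᴴ) (fun _ _ => measurable_const)
    (Measurable.matrix_conjTranspose measurable_entry)
  convert h using 3 with A
  rw [Matrix.one_mul, ← isUnit_conjTranspose_mul_self_iff, conjTranspose_conjTranspose]

/-- Induction on rows: the span of the earlier m rows is proper when m < n, and almost every new row
avoids it. -/
theorem ae_isUnit_mul_conjTranspose (hmn : m ≤ n) :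
    ∀ᵐ A : Fin m → Fin n → ℂ, IsUnit (Matrix.of A * (Matrix.of A)ᴴ) := by
  induction m with
  | zero => exact .of_forall fun A => isUnit_of_subsingleton _
  | succ m ih =>
    have hcons : Measurable fun z : (Fin n → ℂ) × (Fin m → Fin n → ℂ) =>
        (Fin.cons z.1 z.2 : Fin (m + 1) → Fin n → ℂ) := by
      refine measurable_pi_lambda _ fun k => ?_
      refine Fin.cases ?_ (fun k => ?_) k
      · exact measurable_fst
      · exact (measurable_pi_apply k).comp measurable_snd
    have key : ∀ᵐ z : (Fin n → ℂ) × (Fin m → Fin n → ℂ) ∂(volume.prod volume),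
        IsUnit (Matrix.of (Fin.cons z.1 z.2 : Fin (m + 1) → Fin n → ℂ) *
          (Matrix.of (Fin.cons z.1 z.2 : Fin (m + 1) → Fin n → ℂ))ᴴ) := by
      have hms : MeasurableSet {z : (Fin n → ℂ) × (Fin m → Fin n → ℂ) |
          IsUnit (Matrix.of (Fin.cons z.1 z.2 : Fin (m + 1) → Fin n → ℂ) *
            (Matrix.of (Fin.cons z.1 z.2 : Fin (m + 1) → Fin n → ℂ))ᴴ)} :=
        hcons measurableSet_isUnit_mul_conjTranspose
      rw [Measure.ae_prod_iff_ae_ae hms, Measure.ae_ae_comm hms]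
      filter_upwards [ih (by omega)] with B hB
      have hne : Submodule.span ℂ (Set.range B) ≠ ⊤ := by
        intro htop
        have h1 := finrank_range_le_card (R := ℂ) B
        rw [Set.finrank, htop, finrank_top, Module.finrank_fin_fun, Fintype.card_fin] at h1
        omega
      filter_upwards [Submodule.ae_notMem_of_ne_top volume hne] with x hx
      rw [isUnit_mul_conjTranspose_self_iff] at hB ⊢
      exact linearIndependent_finCons.2 ⟨hB, hx⟩
    have h := (volume_preserving_piFinSuccAbove (fun _ : Fin (m + 1) => Fin n → ℂ)
      0).quasiMeasurePreserving.ae key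
    filter_upwards [h] with A hA
    have : (Fin.cons (A 0) (fun j => A j.succ) : Fin (m + 1) → Fin n → ℂ) = A :=
      Fin.cons_self_tail A
    rw [← this]
    exact hA

end Lebesgue

/-! ### Reduction to invariance and conclusion -/

theorem HasGramDensity.isRightUnitarilyInvariant {Ω : Type*} [MeasurableSpace Ω] {μ : Measure Ω}
    {m n : ℕ} (hmn : m ≤ n) {Φ : Ω → Matrix (Fin m) (Fin n) ℂ} (h : HasGramDensity μ Φ) :
    IsRightUnitarilyInvariant μ Φ := by
  obtain ⟨g, hg, hlaw⟩ := h
  refine ⟨hlaw.aemeasurable, fun U hU => ?_, ?_⟩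
  · have h1 := rightUnitarilyInvariant_volume.withDensity_gram hg U hU
    have h2 := AEMeasurable.map_map_of_aemeasurable
      (measurable_mul_right (m := m) U).aemeasurable hlaw.aemeasurable
    rw [hlaw.map_eq] at h2 ⊢
    exact h2.symm.trans h1
  · have h1 : ∀ᵐ A ∂(volume : Measure (Fin m → Fin n → ℂ)).withDensity
        (fun A => g (Matrix.of A * (Matrix.of A)ᴴ)), IsUnit (Matrix.of A * (Matrix.of A)ᴴ) :=
      (withDensity_absolutelyContinuous _ _).ae_le (ae_isUnit_mul_conjTranspose hmn)
    rw [← hlaw.map_eq] at h1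
    exact ae_of_ae_map hlaw.aemeasurable h1

/-- Since W⁻¹ = Lᴴ Ĵ⁻¹ L and Lz = e_i, both forms collapse to diagonal entries. `Jhat` may be
singular: the inverse of a product is the reversed product of inverses under the convention for
singular matrices too. -/
theorem quadForm_normalizedFisherInfo_inv {p : ℕ} {L J Jhat : Matrix (Fin p) (Fin p) ℂ}
    (hL : L * Lᴴ = J) (hJ : IsUnit J) (i : Fin p) {z : Fin p → ℂ} (hz : z = L⁻¹ *ᵥ Pi.single i 1) :
    star z ⬝ᵥ ((normalizedFisherInfo L Jhat)⁻¹ *ᵥ z) = Jhat⁻¹ i i ∧ star z ⬝ᵥ z = J⁻¹ i i := by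
  have hdet : IsUnit L.det := by
    rw [← hL, Matrix.isUnit_iff_isUnit_det, det_mul] at hJ
    exact (IsUnit.mul_iff.1 hJ).1
  have hLz : L *ᵥ z = Pi.single i 1 := by
    rw [hz, mulVec_mulVec, Matrix.mul_nonsing_inv _ hdet, one_mulVec]
  have hdetH : IsUnit Lᴴ.det := by
    rw [det_conjTranspose]; exact hdet.star
  have hsingle : star (Pi.single i 1 : Fin p → ℂ) = Pi.single i 1 := by
    ext j; by_cases h : j = i <;> simp [h]
  constructor
  · rw [normalizedFisherInfo, Matrix.mul_inv_rev, Matrix.mul_inv_rev,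
      Matrix.nonsing_inv_nonsing_inv _ hdet, Matrix.nonsing_inv_nonsing_inv _ hdetH,
      ← mulVec_mulVec, ← mulVec_mulVec, hLz, dotProduct_mulVec, ← star_mulVec, hLz, hsingle]
    simp
  · rw [← hL, Matrix.mul_inv_rev, hz, star_mulVec, ← dotProduct_mulVec, mulVec_mulVec,
      conjTranspose_nonsing_inv, hsingle]
    simp

theorem inv_smul_apply_div_inv_smul_apply {p : ℕ} {c : ℂ} (hc : c ≠ 0)
    {C D : Matrix (Fin p) (Fin p) ℂ} (hC : IsUnit C) (hD : IsUnit D) (i : Fin p) :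
    (c • C)⁻¹ i i / (c • D)⁻¹ i i = C⁻¹ i i / D⁻¹ i i := by
  have := invertibleOfNonzero hc
  have h : ∀ B : Matrix (Fin p) (Fin p) ℂ, IsUnit B → (c • B)⁻¹ i i = ⅟c * B⁻¹ i i :=
    fun B hB => congrFun (congrFun
      (Matrix.inv_smul B c ((Matrix.isUnit_iff_isUnit_det _).1 hB)) i) i
  rw [h C hC, h D hD, mul_div_mul_left _ _ (Invertible.ne_zero (⅟c))]

theorem isUnit_smul_matrix_iff {p : ℕ} {c : ℂ} (hc : c ≠ 0) {C : Matrix (Fin p) (Fin p) ℂ} :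
    IsUnit (c • C) ↔ IsUnit C := by
  rw [Matrix.isUnit_iff_isUnit_det, Matrix.isUnit_iff_isUnit_det, det_smul, IsUnit.mul_iff]
  exact and_iff_right (hc.isUnit.pow _)

/-- For each parameter, the CRB after compression divided by the CRB before compression equals
`zᴴ W⁻¹ z / zᴴ z` and is distributed as the inverse of a `Beta(m - p + 1, n - m)` variable; the
distribution involves `m`, `n`, `p` only. -/
theorem mainTheorem3 {m n p : ℕ} (hpm : p ≤ m) (hmn : m + p ≤ n)
    {Ω : Type*} [MeasurableSpace Ω] (μ : Measure Ω) [IsProbabilityMeasure μ]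
    (σ : ℝ) (hσ : 0 < σ)
    (x : (Fin p → ℝ) → (Fin n → ℂ)) (θ : Fin p → ℝ)
    (hx : ∀ j, DifferentiableAt ℝ (fun t : ℝ => x (Function.update θ j t)) (θ j))
    (hJ : IsUnit (fisherInfo σ x θ))
    (Φ : Ω → Matrix (Fin m) (Fin n) ℂ)
    (hΦ : IsIIDComplexNormal μ Φ ∨ HasGramDensity μ Φ ∨ IsRightUnitarilyInvariant μ Φ)
    (i : Fin p) :
    (∀ᵐ ω ∂μ, IsUnit (Φ ω * (Φ ω)ᴴ) ∧ IsUnit (compressedFisherInfo σ x θ (Φ ω))) ∧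
    (∀ L : Matrix (Fin p) (Fin p) ℂ, L * Lᴴ = fisherInfo σ x θ →
      ∀ z : Fin p → ℂ, z = L⁻¹ *ᵥ Pi.single i 1 →
      ∀ᵐ ω ∂μ,
        (compressedFisherInfo σ x θ (Φ ω))⁻¹ i i / (fisherInfo σ x θ)⁻¹ i i =
          (star z ⬝ᵥ
              ((normalizedFisherInfo L (compressedFisherInfo σ x θ (Φ ω)))⁻¹ *ᵥ z)) /
            (star z ⬝ᵥ z)) ∧
    HasLaw (fun ω => (compressedFisherInfo σ x θ (Φ ω))⁻¹ i i / (fisherInfo σ x θ)⁻¹ i i)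
      ((betaMeasure ((m : ℝ) - p + 1) ((n : ℝ) - m)).map fun b : ℝ => ((b⁻¹ : ℝ) : ℂ)) μ := by
  have hp : 0 < p := i.pos
  have hinv : IsRightUnitarilyInvariant μ Φ := by
    rcases hΦ with h | h | h
    · exact (h.hasGramDensity (by omega) (by omega)).isRightUnitarilyInvariant (by omega)
    · exact h.isRightUnitarilyInvariant (by omega)
    · exact h
  obtain ⟨hΦm, hΦU, hΦr⟩ := hinv
  set G := sensitivityMatrix x θ with hG
  have hc : (((1 / σ ^ 2 : ℝ)) : ℂ) ≠ 0 := by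
    exact_mod_cast (by positivity : (1 / σ ^ 2 : ℝ) ≠ 0)
  have hGG : IsUnit (Gᴴ * G) := (isUnit_smul_matrix_iff hc).1 hJ
  have hGinj := isUnit_conjTranspose_mul_self_iff.1 hGG
  set P : Measure (Fin m → Fin n → ℂ) := μ.map (fun ω k l => Φ ω k l) with hPdef
  have hPprob : IsProbabilityMeasure P := Measure.isProbabilityMeasure_map hΦm
  have hP : RightUnitarilyInvariant P := fun U hU =>
    (AEMeasurable.map_map_of_aemeasurable (measurable_mul_right (m := m) U).aemeasurable
      hΦm).trans (hΦU U hU)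
  have hPr : ∀ᵐ A ∂P, IsUnit (Matrix.of A * (Matrix.of A)ᴴ) :=
    (ae_map_iff hΦm measurableSet_isUnit_mul_conjTranspose).2 hΦr
  have hinj : ∀ᵐ ω ∂μ, Function.Injective (Φ ω * G).mulVec :=
    ae_of_ae_map hΦm (hP.ae_injective_mul hPr hpm G hGinj)
  have hunit : ∀ᵐ ω ∂μ, IsUnit ((rowProj (Φ ω) * G)ᴴ * (rowProj (Φ ω) * G)) := by
    filter_upwards [hΦr, hinj] with ω h1 h2 using isUnit_compressed_gram h1 h2
  -- The quadratic-form identity holds at every ω, not only almost surely.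
  refine ⟨?_, fun L hL z hz => .of_forall fun ω => ?_, ?_⟩
  · filter_upwards [hΦr, hunit] with ω h1 h2
    exact ⟨h1, (isUnit_smul_matrix_iff hc).2 h2⟩
  · obtain ⟨h1, h2⟩ := quadForm_normalizedFisherInfo_inv
      (Jhat := compressedFisherInfo σ x θ (Φ ω)) hL hJ i hz
    rw [h1, h2]
  · have hcrb : Measurable fun A : Fin m → Fin n → ℂ => crbRatio (Matrix.of A) G i :=
      Measurable.crbRatio (A := fun A : Fin m → Fin n → ℂ => Matrix.of A) (G := fun _ => G)
        measurable_entry (fun _ _ => measurable_const) i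
    have hlaw : HasLaw (fun ω => crbRatio (Φ ω) G i)
        ((betaMeasure ((m : ℝ) - p + 1) ((n : ℝ) - m)).map fun b : ℝ => ((b⁻¹ : ℝ) : ℂ)) μ :=
      ⟨hcrb.comp_aemeasurable hΦm, by
        rw [← hP.map_crbRatio hPr hpm hmn G hGinj i]
        exact (AEMeasurable.map_map_of_aemeasurable hcrb.aemeasurable hΦm).symm⟩
    -- The scalar σ⁻² cancels wherever the compressed Gram matrix is invertible, that is, almost
    -- surely.
    refine hlaw.congr ?_
    filter_upwards [hunit] with ω h
    exact inv_smul_apply_div_inv_smul_apply hc h hGG i
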